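/- **Setting.** Let $n\ge 1$ agents be connected by a connected undirected graph with a weight matrix $W\in\mathbb R^{n\times n}$ that vanishes off the diagonal outside the edges, is symmetric with $W\mathbf 1=\mathbf 1$, and satisfies $\operatorname{null}(I-W)=\operatorname{span}\{\mathbf 1\}$ and $I+W\succ 0$. Put $\delta = 1-\|W-\tfrac1n\mathbf 1\mathbf 1^{\mathsf T}\|_2$ and $\beta=\|I-W\|_2$. Let $d\ge1$ and let $\Omega\subseteq\mathbb R^d$ be closed and convex with $\{\|x\|\le\underline R\}\subseteq\Omega\subseteq\{\|x\|\le\bar R\}$, $\underline R>0$. Agent $i$ has the loss $f_i(x)=\mathbb E_{\xi\sim\mathcal P_i}[F_i(x,\xi)]$, and $f=\frac1n\sum_i f_i$ is to be minimized over $\Omega$. For almost every $\xi$ the function $F_i(\cdot,\xi)$ is convex and $L_f$-Lipschitz on $\Omega$; for all $x\in\Omega$ the gradients $\nabla_xF_i(x,\xi)$ (for almost every $\xi$) and $\nabla f_i(x)$ exist, with $\mathbb E\|\nabla_xF_i(x,\xi)-\nabla f_i(x)\|^2\le\hat\sigma^2$, and $\nabla f_i$ is $L_m$-Lipschitz on $\Omega$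 ($L_f,L_m,\hat\sigma>0$; gradients are taken within $\Omega$). The random compressor $\mathcal C:\mathbb R^d\to\mathbb R^d$ satisfies $\mathbb E_{\mathcal C}\|\tfrac1r\mathcal C(x)-x\|^2\le(1-\omega)\|x\|^2$ for all $x\in\mathbb R^d$, where $r\ge1$ and $\omega\in(0,1]$. **Algorithm (Com-DSZO).** Let $\Omega_\epsilon=\{(1-\epsilon)x: x\in\Omega\}$. Start from arbitrary $x_{i,0}\in\Omega$, $\hat x_{i,0}=b_{i,0}=0$, $q_{i,0}=\mathcal C(x_{i,0})$, and for $k\ge 0$ put $$\hat x_{i,k+1}=\hat x_{i,k}+\psi q_{i,k},\qquad b_{i,k+1}=b_{i,k}+\psi\Big(q_{i,k}-\sum_jW_{ij}q_{j,k}\Big),$$ $$x_{i,k+1}=\Pi_{\Omega_\epsilon}\big[x_{i,k}-\gamma b_{i,k+1}-\eta_kg_{i,k}\big],\qquad q_{i,k+1}=\mathcal C(x_{i,k+1}-\hat x_{i,k+1}),$$ $$g_{i,k}=\tfrac d\mu\big(F_i(x_{i,k}+\mu u_{i,k},\xi_{i,k})-F_i(x_{i,k},\xi_{i,k})\big)u_{i,k},$$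 with $u_{i,k}$ uniform on the unit sphere, $\xi_{i,k}\sim\mathcal P_i$ and the compressor's randomness independent of each other and over the iterations. Let $\bar x_k=\frac1n\sum_ix_{i,k}$. **Parameters.** For a horizon $T\ge1$: $\mu=1/\sqrt T$, $\epsilon=2\underline R/\sqrt T<1$, $\psi\in(0,r^{-1}]$, $\eta_k=\frac1{M_1\sqrt{k+c}}$ with $M_1=(5+\frac{10}n)4dL_m$ and $c>4$; moreover $2\underline R^2\ge1$, i.e. $\mu\le\epsilon\underline R$, so that all query points from $\Omega_\epsilon$ stay in $\Omega$. With $c_0=\psi r\omega/2$, $\kappa_1=\frac\delta4+2(1+c_0^{-1})^2\gamma\beta^2$ and $\kappa_2=(1+c_0^{-1})^2\gamma\beta^2+(1+\frac2\delta)\beta^2$, the gain $\gamma$ satisfies $0<\gamma<\min\{1,\delta/\kappa_1,c_0/\kappa_2\}$ (with $c_0/\kappa_2=+\infty$ if $\kappa_2=0$). **Claim.** There is a constant $K$ depending only on $n,\delta,\beta,L_f,L_m,\hat\sigma,\underline R,\bar R$ and $\gamma$ (not on $T$, $c$, $d$, $\psi$, $r$, $\omega$, nor on the losses, the set $\Omega$,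 the compressor or the starting points) such that, for every minimizer $x^*$ of $f$ over $\Omega$, the variables $f(\bar x_k)-f(x^*)$, $1\le k\le T$, are integrable and $$\sum_{k=1}^T\mathbb E\big[f(\bar x_k)-f(x^*)\big]\le K\,\frac{d^2\sqrt{T+c}}{(\psi r\omega)^2}.$$ In particular, if $\psi r\omega\ge\rho>0$ (high compression fidelity: $\rho$ close to $1$), the sum is at most $\frac{K}{\rho^2}\,d^2\sqrt{T+c}$. -/

import Mathlib

open MeasureTheory ProbabilityTheory

noncomputable section

namespace ComDSZO

/-- The decision space `ℝ^d` with the Euclidean norm. -/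
abbrev Vec (d : ℕ) : Type := EuclideanSpace ℝ (Fin d)

/-! ### The network -/

/-- `G` is a connected undirected graph on the agents and `W` is a weight matrix of it: off-diagonal
weights vanish outside the edges, `W` is symmetric with row sums (hence column sums) one, the null
space of `I - W` is spanned by the all-ones vector, and `I + W` is positive definite. -/
structure IsNetwork {n : ℕ} (G : SimpleGraph (Fin n)) (W : Matrix (Fin n) (Fin n) ℝ) : Prop where
  connected : G.Connected
  support : ∀ i j, i ≠ j → ¬ G.Adj i j → W i j = 0
  symm : W.IsSymm
  row_sum : ∀ i, ∑ j, W i j = 1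
  null_space : ∀ v : Fin n → ℝ, (1 - W).mulVec v = 0 → ∃ a : ℝ, v = fun _ => a
  posDef : (1 + W).PosDef

/-- The spectral norm of a square matrix. -/
def specNorm {n : ℕ} (A : Matrix (Fin n) (Fin n) ℝ) : ℝ :=
  ‖Matrix.toEuclideanCLM (𝕜 := ℝ) A‖

/-- The averaging matrix `H = (1/n) 1 1ᵀ`. -/
def averaging (n : ℕ) : Matrix (Fin n) (Fin n) ℝ := Matrix.of fun _ _ => 1 / (n : ℝ)

/-- The spectral gap `δ`, that is `‖W - H‖₂ = 1 - δ`. -/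
def spectralGap {n : ℕ} (W : Matrix (Fin n) (Fin n) ℝ) : ℝ := 1 - specNorm (W - averaging n)

/-- `β = ‖I - W‖₂`. -/
def laplacianNorm {n : ℕ} (W : Matrix (Fin n) (Fin n) ℝ) : ℝ := specNorm (1 - W)

/-! ### The stochastic constrained problem -/

/-- `X` is closed and convex, contains the ball of radius `Rlo` around the origin and is contained in
the ball of radius `Rhi`. -/
structure IsConstraintSet {d : ℕ} (X : Set (Vec d)) (Rlo Rhi : ℝ) : Prop where
  closed : IsClosed X
  convex : Convex ℝ X
  inner_ball : Metric.closedBall 0 Rlo ⊆ X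
  outer_ball : X ⊆ Metric.closedBall 0 Rhi

/-- `f_i(x) = 𝔼_{ξ ∼ P_i} F_i(x, ξ)`. -/
def localLoss {n d : ℕ} {Ξ : Type*} [MeasurableSpace Ξ] (F : Fin n → Vec d → Ξ → ℝ)
    (P : Fin n → Measure Ξ) (i : Fin n) (x : Vec d) : ℝ :=
  ∫ z, F i x z ∂(P i)

/-- `f(x) = (1/n) ∑ i, f_i(x)`. -/
def globalLoss {n d : ℕ} {Ξ : Type*} [MeasurableSpace Ξ] (F : Fin n → Vec d → Ξ → ℝ)
    (P : Fin n → Measure Ξ) (x : Vec d) : ℝ :=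
  (1 / (n : ℝ)) * ∑ i, localLoss F P i x

/-- The standing assumptions on the random losses. Only the values on `X` matter, so gradients are
taken within `X`; when `X` has interior points and the function is differentiable in a neighbourhood
of a point of `X`, this is its ordinary gradient there. -/
structure IsSmoothProblem {n d : ℕ} {Ξ : Type*} [MeasurableSpace Ξ] (X : Set (Vec d))
    (F : Fin n → Vec d → Ξ → ℝ) (P : Fin n → Measure Ξ) (Lf Lm σ : ℝ) : Prop where
  measurable : ∀ i, Measurable (Function.uncurry (F i))
  integrable : ∀ i, ∀ x ∈ X, Integrable (F i x) (P i)
  convex : ∀ i, ∀ᵐ z ∂(P i), ConvexOn ℝ X fun x => F i x z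
  lipschitz : ∀ i, ∀ᵐ z ∂(P i), ∀ x ∈ X, ∀ y ∈ X, |F i x z - F i y z| ≤ Lf * ‖x - y‖
  differentiable_sample : ∀ i, ∀ x ∈ X, ∀ᵐ z ∂(P i),
    DifferentiableWithinAt ℝ (fun y => F i y z) X x
  differentiable : ∀ i, DifferentiableOn ℝ (localLoss F P i) X
  variance : ∀ i, ∀ x ∈ X,
    ∫⁻ z, ‖gradientWithin (fun y => F i y z) X x - gradientWithin (localLoss F P i) X x‖ₑ ^ 2 ∂(P i)
      ≤ ENNReal.ofReal (σ ^ 2)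
  smooth : ∀ i, ∀ x ∈ X, ∀ y ∈ X,
    ‖gradientWithin (localLoss F P i) X x - gradientWithin (localLoss F P i) X y‖ ≤ Lm * ‖x - y‖

/-! ### Compressors -/

/-- A random compressor `C(x, z)` with internal randomness `z ∼ ν`, whose rescaling `C / r` has
relative mean square error at most `1 - ω`. -/
structure IsCompressor {d : ℕ} {Z : Type*} [MeasurableSpace Z] (C : Vec d → Z → Vec d)
    (ν : Measure Z) (r ω : ℝ) : Prop where
  measurable : Measurable (Function.uncurry C)
  error : ∀ x : Vec d,
    ∫⁻ z, ‖(1 / r) • C x z - x‖ₑ ^ 2 ∂ν ≤ ENNReal.ofReal ((1 - ω) * ‖x‖ ^ 2)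

/-! ### The algorithm -/

/-- The shrunk set `Ω_ε = {(1 - ε) x | x ∈ Ω}`. -/
def shrink {d : ℕ} (X : Set (Vec d)) (ε : ℝ) : Set (Vec d) := (fun x => (1 - ε) • x) '' X

open Classical in
/-- The projection `argmin_{x ∈ K} ‖x - z‖²` (unique when `K` is closed, convex and non-empty). -/
def proj {d : ℕ} (K : Set (Vec d)) (z : Vec d) : Vec d :=
  if h : ∃ x ∈ K, ∀ y ∈ K, ‖x - z‖ ^ 2 ≤ ‖y - z‖ ^ 2 then h.choose else z

/-- The uniform probability distribution on the unit sphere of `ℝ^d`, as a measure on `ℝ^d`. -/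
def sphereUniform (d : ℕ) : Measure (Vec d) :=
  (((volume : Measure (Vec d)).toSphere Set.univ)⁻¹ • (volume : Measure (Vec d)).toSphere).map
    Subtype.val

/-- The two-point estimator `(d/μ) (F(x + μ u, ξ) - F(x, ξ)) u`. -/
def gradEst {d : ℕ} {Ξ : Type*} (F : Vec d → Ξ → ℝ) (μ : ℝ) (x u : Vec d) (z : Ξ) : Vec d :=
  ((d : ℝ) / μ) • ((F (x + μ • u) z - F x z) • u)

/-- The input parameters of the algorithm. -/
structure Params where
  /-- step sizes -/
  η : ℕ → ℝ
  /-- smoothing radius -/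
  μ : ℝ
  /-- shrinkage factor -/
  ε : ℝ
  /-- compression gain -/
  ψ : ℝ
  /-- consensus gain -/
  γ : ℝ

/-- The variables `x_i`, `x̂_i`, `b_i`, `q_i` of all agents. -/
structure State (n d : ℕ) where
  x : Fin n → Vec d
  xhat : Fin n → Vec d
  b : Fin n → Vec d
  q : Fin n → Vec d

/-- The Com-DSZO algorithm along one realisation of the directions `u k i`, the data samples `ξ k i`
and the compressor randomness `ζ k i`. The sum over the neighbours of `i` (with `i` itself) is
written over all agents, since the other weights vanish. -/
def run {n d : ℕ} {Ξ Z : Type*} (p : Params) (W : Matrix (Fin n) (Fin n) ℝ) (X : Set (Vec d))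
    (F : Fin n → Vec d → Ξ → ℝ) (C : Vec d → Z → Vec d) (x₀ : Fin n → Vec d)
    (u : ℕ → Fin n → Vec d) (ξ : ℕ → Fin n → Ξ) (ζ : ℕ → Fin n → Z) : ℕ → State n d
  | 0 =>
    { x := x₀
      xhat := fun _ => 0
      b := fun _ => 0
      q := fun i => C (x₀ i) (ζ 0 i) }
  | k + 1 =>
    let s := run p W X F C x₀ u ξ ζ k
    let xhat' : Fin n → Vec d := fun i => s.xhat i + p.ψ • s.q i
    let b' : Fin n → Vec d := fun i => s.b i + p.ψ • (s.q i - ∑ j, W i j • s.q j)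
    let x' : Fin n → Vec d := fun i =>
      proj (shrink X p.ε)
        (s.x i - p.γ • b' i - p.η k • gradEst (F i) p.μ (s.x i) (u k i) (ξ k i))
    { x := x'
      xhat := xhat'
      b := b'
      q := fun i => C (x' i - xhat' i) (ζ (k + 1) i) }

/-- The network average `x̄_k`. -/
def State.avg {n d : ℕ} (s : State n d) : Vec d := (1 / (n : ℝ)) • ∑ i, s.x i

/-- The random inputs: at every iteration and for every agent the direction is uniform on the unit
sphere, the data sample has law `P i`, the compressor randomness has law `ν`, these three are
independent, and the inputs of different iterations are independent. No independence between
different agents within one iteration is imposed. -/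
structure IsSampling {n d : ℕ} {Ξ Z S : Type*} [MeasurableSpace Ξ] [MeasurableSpace Z]
    [MeasurableSpace S] (Pr : Measure S) (P : Fin n → Measure Ξ) (ν : Measure Z)
    (u : ℕ → Fin n → S → Vec d) (ξ : ℕ → Fin n → S → Ξ) (ζ : ℕ → Fin n → S → Z) : Prop where
  measurable_u : ∀ k i, Measurable (u k i)
  measurable_ξ : ∀ k i, Measurable (ξ k i)
  measurable_ζ : ∀ k i, Measurable (ζ k i)
  law : ∀ k i, Pr.map (fun s => (u k i s, ξ k i s, ζ k i s))
    = (sphereUniform d).prod ((P i).prod ν)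
  indep : iIndepFun (fun k s i => (u k i s, ξ k i s, ζ k i s)) Pr

/-! ### The parameters -/

/-- `κ₁ = δ/4 + 2 (1 + c₀⁻¹)² γ β²`. -/
def kappa1 (δ β γ c₀ : ℝ) : ℝ := δ / 4 + 2 * (1 + c₀⁻¹) ^ 2 * γ * β ^ 2

/-- `κ₂ = (1 + c₀⁻¹)² γ β² + (1 + 2/δ) β²`. -/
def kappa2 (δ β γ c₀ : ℝ) : ℝ := (1 + c₀⁻¹) ^ 2 * γ * β ^ 2 + (1 + 2 / δ) * β ^ 2

/-- `0 < γ < min {1, δ/κ₁, c₀/κ₂}`, written without division so that `κ₂ = 0` (a single agent)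
imposes no constraint. -/
def GammaAdmissible (δ β γ c₀ : ℝ) : Prop :=
  0 < γ ∧ γ < 1 ∧ γ * kappa1 δ β γ c₀ < δ ∧ γ * kappa2 δ β γ c₀ < c₀

/-- The parameters for the horizon `T`: `μ = 1/√T`, `ε = 2 Rlo/√T` and `η_k = 1/(M₁ √(k + c))` with
`M₁ = (5 + 10/n) 4 d L_m`. -/
def smoothParams (n d T : ℕ) (Lm Rlo c ψ γ : ℝ) : Params where
  η := fun k => 1 / ((5 + 10 / (n : ℝ)) * 4 * d * Lm * Real.sqrt (k + c))
  μ := 1 / Real.sqrt T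
  ε := 2 * Rlo / Real.sqrt T
  ψ := ψ
  γ := γ

end ComDSZO

end

/-! The auxiliary variables can be eliminated. Linearity gives b_k = (I - W) x̂_k (`b_eq`), and
x̂_{k+1} = x_k - e_k, where e_k is what remains of x_k - x̂_k after its compressed correction. One
iteration is therefore projected descent with an inexact consensus term, x_{k+1} = Π[x_k - γ (I -
W)(x_k - e_k) - η_k g_k] (`x_succ`). From k = 1 on the iterates lie in Ω_ε, all queries stay in Ω,
and Lipschitz losses give ‖g_{i,k}‖ ≤ d L_f almost surely, whatever μ is. Since η_k carries a factor
1/d, the gradient step is a perturbation of size B/√(k+c) with B free of the dimension.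

Let a_k and p_k be the root mean squares of the disagreement and of e_k, and c₀ = ψrω/2. The
spectral gap contracts a_k by 1 - γδ, the compressor contracts p_k by 1 - c₀, and each feeds the
other through γβ. In the norm a + (δ/β) p the coupled system contracts (`coupled_contraction`). The
κ₂ condition forces c₀ > γβ²(1 + 2/δ), so the rate can be written in γ, δ, β alone; this keeps the
compressor out of the constant. A perturbed contraction then gives Σ √(k+c) (a_k² + β² p_k²) =
O(√(T+c)) (`sum_weight_mul_sq_le`, `sum_energy_le`).

For the regret, expand ‖x_{k+1} - y‖² with y ∈ Ω_ε. The consensus term sums to zero over the agents,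
so it meets only the disagreement. Given the past, ⟨x_i - y, g_i⟩ has mean at least f_i(x_i) -
f_i(y) - O(dμ), because a uniform direction has second moment I/d and f_i is convex
(`inner_gradEst_ge`). Dividing by 2η_k and summing by parts over the bounded set yields
`sum_gap_le`. The bias and the replacement of x* by (1-ε)x* cost T · O(d/√T) and T · O(1/√T).

The outcome is K d √(T+c), and the claim follows from d ≥ 1 and ψrω ≤ 1. Expectations are taken
agent by agent and combined by Minkowski's inequality, so dependence between agents within an
iteration is harmless. -/

namespace ComDSZO

/-! ### Stacked vectors -/

/-- The Euclidean norm of the stacked vector `(x₁, …, xₙ)`. -/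
noncomputable def stackNorm {n d : ℕ} (x : Fin n → Vec d) : ℝ :=
  ‖(WithLp.toLp 2 x : PiLp 2 fun _ : Fin n => Vec d)‖

/-- The action of a weight matrix on stacked vectors. -/
noncomputable def mix {n d : ℕ} (A : Matrix (Fin n) (Fin n) ℝ) (x : Fin n → Vec d) :
    Fin n → Vec d :=
  fun i => ∑ j, A i j • x j

/-- The average of the blocks of a stacked vector. -/
noncomputable def mean {n d : ℕ} (x : Fin n → Vec d) : Vec d := (1 / (n : ℝ)) • ∑ i, x i

/-- The deviation of the blocks from their average. -/
noncomputable def dev {n d : ℕ} (x : Fin n → Vec d) : Fin n → Vec d := fun i => x i - mean x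

section Stack

variable {n d : ℕ}

lemma stackNorm_nonneg (x : Fin n → Vec d) : 0 ≤ stackNorm x := norm_nonneg _

lemma stackNorm_sq (x : Fin n → Vec d) : stackNorm x ^ 2 = ∑ i, ‖x i‖ ^ 2 := by
  rw [stackNorm, PiLp.norm_sq_eq_of_L2]

lemma stackNorm_add_le (x y : Fin n → Vec d) :
    stackNorm (x + y) ≤ stackNorm x + stackNorm y := by
  rw [stackNorm, WithLp.toLp_add]; exact norm_add_le _ _

lemma stackNorm_sub_le (x y : Fin n → Vec d) :
    stackNorm (x - y) ≤ stackNorm x + stackNorm y := by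
  rw [stackNorm, WithLp.toLp_sub]; exact norm_sub_le _ _

lemma stackNorm_smul (a : ℝ) (x : Fin n → Vec d) : stackNorm (a • x) = |a| * stackNorm x := by
  rw [stackNorm, WithLp.toLp_smul, norm_smul, Real.norm_eq_abs]; rfl

lemma stackNorm_le_of_sq_le {x : Fin n → Vec d} {a : ℝ} (ha : 0 ≤ a)
    (h : ∑ i, ‖x i‖ ^ 2 ≤ a ^ 2) : stackNorm x ≤ a := by
  rw [← stackNorm_sq] at h
  exact abs_le_of_sq_le_sq' h ha |>.2

lemma stackNorm_mono {x y : Fin n → Vec d} (h : ∑ i, ‖x i‖ ^ 2 ≤ ∑ i, ‖y i‖ ^ 2) :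
    stackNorm x ≤ stackNorm y :=
  stackNorm_le_of_sq_le (stackNorm_nonneg _) (by rwa [stackNorm_sq])

lemma norm_le_stackNorm (x : Fin n → Vec d) (i : Fin n) : ‖x i‖ ≤ stackNorm x := by
  apply abs_le_of_sq_le_sq' _ (stackNorm_nonneg _) |>.2
  rw [stackNorm_sq]
  exact Finset.single_le_sum (f := fun i => ‖x i‖ ^ 2) (fun _ _ => by positivity)
    (Finset.mem_univ i)

lemma stackNorm_le_of_forall {x : Fin n → Vec d} {a : ℝ} (ha : 0 ≤ a) (h : ∀ i, ‖x i‖ ≤ a) :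
    stackNorm x ≤ Real.sqrt n * a := by
  apply stackNorm_le_of_sq_le (by positivity)
  rw [mul_pow, Real.sq_sqrt (by positivity)]
  calc ∑ i, ‖x i‖ ^ 2 ≤ ∑ _i : Fin n, a ^ 2 := by
        gcongr with i; exact h i
    _ = n * a ^ 2 := by simp

lemma sum_norm_le_stackNorm (x : Fin n → Vec d) : ∑ i, ‖x i‖ ≤ Real.sqrt n * stackNorm x := by
  have h := Finset.sum_mul_sq_le_sq_mul_sq (Finset.univ : Finset (Fin n))
    (fun _ => (1 : ℝ)) (fun i => ‖x i‖)
  apply abs_le_of_sq_le_sq' _ (mul_nonneg (Real.sqrt_nonneg _) (stackNorm_nonneg _)) |>.2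
  rw [mul_pow, Real.sq_sqrt (by positivity), stackNorm_sq]
  simpa using h

lemma sum_inner_le (x y : Fin n → Vec d) :
    |∑ i, inner ℝ (x i) (y i)| ≤ stackNorm x * stackNorm y := by
  have := abs_real_inner_le_norm (WithLp.toLp 2 x : PiLp 2 fun _ : Fin n => Vec d)
    (WithLp.toLp 2 y)
  simpa [PiLp.inner_apply, stackNorm] using this

lemma specNorm_nonneg (A : Matrix (Fin n) (Fin n) ℝ) : 0 ≤ specNorm A := norm_nonneg _

lemma sum_mulVec_sq_le (A : Matrix (Fin n) (Fin n) ℝ) (v : Fin n → ℝ) :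
    ∑ i, (∑ j, A i j * v j) ^ 2 ≤ specNorm A ^ 2 * ∑ i, v i ^ 2 := by
  have h := (Matrix.toEuclideanCLM (𝕜 := ℝ) A).le_opNorm (WithLp.toLp 2 v)
  have h2 := pow_le_pow_left₀ (norm_nonneg _) h 2
  rw [mul_pow, EuclideanSpace.norm_sq_eq, EuclideanSpace.norm_sq_eq] at h2
  simpa [Matrix.mulVec, dotProduct, specNorm] using h2

lemma stackNorm_mix_le (A : Matrix (Fin n) (Fin n) ℝ) (x : Fin n → Vec d) :
    stackNorm (mix A x) ≤ specNorm A * stackNorm x := by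
  apply stackNorm_le_of_sq_le (mul_nonneg (specNorm_nonneg _) (stackNorm_nonneg _))
  rw [mul_pow, stackNorm_sq]
  simp only [EuclideanSpace.norm_sq_eq, Real.norm_eq_abs, sq_abs]
  rw [Finset.sum_comm, Finset.sum_comm (s := Finset.univ (α := Fin n)), Finset.mul_sum]
  gcongr with c
  simpa [mix] using sum_mulVec_sq_le A (fun j => x j c)

lemma mix_sub (A : Matrix (Fin n) (Fin n) ℝ) (x y : Fin n → Vec d) :
    mix A (x - y) = mix A x - mix A y := by
  ext1 i; simp [mix, smul_sub]

lemma mix_add (A : Matrix (Fin n) (Fin n) ℝ) (x y : Fin n → Vec d) :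
    mix A (x + y) = mix A x + mix A y := by
  ext1 i; simp [mix, Finset.sum_add_distrib]

lemma mix_smul (A : Matrix (Fin n) (Fin n) ℝ) (a : ℝ) (x : Fin n → Vec d) :
    mix A (a • x) = a • mix A x := by
  ext1 i; simp [mix, Finset.smul_sum, smul_comm a]

lemma mix_one_sub (A : Matrix (Fin n) (Fin n) ℝ) (x : Fin n → Vec d) :
    mix (1 - A) x = x - mix A x := by
  ext1 i
  simp [mix, sub_smul, Matrix.one_apply, ite_smul]

lemma sum_dev (hn : n ≠ 0) (x : Fin n → Vec d) : ∑ i, dev x i = 0 := by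
  have : (n : ℝ) ≠ 0 := by exact_mod_cast hn
  simp only [dev, Finset.sum_sub_distrib, mean]
  rw [Finset.sum_const, Finset.card_univ, Fintype.card_fin, ← Nat.cast_smul_eq_nsmul ℝ, smul_smul,
    mul_one_div_cancel this, one_smul, sub_self]

lemma mean_sub (x y : Fin n → Vec d) : mean (x - y) = mean x - mean y := by
  simp [mean, smul_sub]

lemma mean_smul (a : ℝ) (x : Fin n → Vec d) : mean (a • x) = a • mean x := by
  simp only [mean, Pi.smul_apply, ← Finset.smul_sum]; rw [smul_comm]

lemma dev_sub (x y : Fin n → Vec d) : dev (x - y) = dev x - dev y := by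
  ext1 i; simp only [dev, mean_sub, Pi.sub_apply]; abel

lemma dev_smul (a : ℝ) (x : Fin n → Vec d) : dev (a • x) = a • dev x := by
  ext1 i; simp only [dev, mean_smul, Pi.smul_apply, smul_sub]

lemma dev_eq_of_sum_eq_zero {x : Fin n → Vec d} (h : ∑ i, x i = 0) : dev x = x := by
  ext1 i; simp [dev, mean, h]

/-- The average minimises the sum of squared distances to the blocks. -/
lemma stackNorm_dev_le_sub_const (hn : n ≠ 0) (x : Fin n → Vec d) (z : Vec d) :
    stackNorm (dev x) ≤ stackNorm (fun i => x i - z) := by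
  apply stackNorm_mono
  have h : ∀ i, ‖x i - z‖ ^ 2 = ‖dev x i‖ ^ 2 + 2 * inner ℝ (dev x i) (mean x - z)
      + ‖mean x - z‖ ^ 2 := fun i => by
    rw [← norm_add_sq_real]; congr 2; simp [dev]
  simp_rw [h, Finset.sum_add_distrib, ← Finset.mul_sum, ← sum_inner, sum_dev hn]
  rw [inner_zero_left]
  have : 0 ≤ ∑ _i : Fin n, ‖mean x - z‖ ^ 2 := Finset.sum_nonneg fun _ _ => by positivity
  linarith

lemma stackNorm_dev_le (hn : n ≠ 0) (x : Fin n → Vec d) : stackNorm (dev x) ≤ stackNorm x := by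
  simpa using stackNorm_dev_le_sub_const hn x 0

/-- A zero-sum b is orthogonal to constant stacks. In the descent inequality this removes the
comparator from the consensus term. -/
lemma sum_inner_dev (x b : Fin n → Vec d) (y : Vec d) (hb : ∑ i, b i = 0) :
    ∑ i, inner ℝ (x i - y) (b i) = ∑ i, inner ℝ (dev x i) (b i) := by
  have h : ∀ i, inner ℝ (x i - y) (b i) = inner ℝ (dev x i) (b i) + inner ℝ (mean x - y) (b i) :=
    fun i => by rw [← inner_add_left]; congr 1; simp [dev]
  simp_rw [h, Finset.sum_add_distrib, ← inner_sum, hb, inner_zero_right, add_zero]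

end Stack

/-! ### Spectral facts about the network -/

section Network

variable {n d : ℕ} {G : SimpleGraph (Fin n)} {W : Matrix (Fin n) (Fin n) ℝ}

lemma IsNetwork.ne_zero (hW : IsNetwork G W) : n ≠ 0 := by
  have := hW.connected.nonempty
  rintro rfl
  exact this.elim fun i => i.elim0

lemma IsNetwork.col_sum (hW : IsNetwork G W) (j : Fin n) : ∑ i, W i j = 1 := by
  rw [← hW.row_sum j]
  exact Finset.sum_congr rfl fun i _ => (hW.symm.apply i j).symm

lemma IsNetwork.sum_mix_one_sub (hW : IsNetwork G W) (x : Fin n → Vec d) :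
    ∑ i, mix (1 - W) x i = 0 := by
  rw [mix_one_sub]
  simp only [Pi.sub_apply, Finset.sum_sub_distrib, mix]
  rw [Finset.sum_comm]
  simp_rw [← Finset.sum_smul, hW.col_sum, one_smul, sub_self]

lemma IsNetwork.mix_one_sub_const (hW : IsNetwork G W) (z : Vec d) :
    mix (1 - W) (fun _ => z) = 0 := by
  rw [mix_one_sub]
  ext1 i
  simp only [Pi.sub_apply, mix, ← Finset.sum_smul, hW.row_sum, one_smul, sub_self]
  rfl

lemma IsNetwork.mix_one_sub_dev (hW : IsNetwork G W) (x : Fin n → Vec d) :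
    mix (1 - W) (dev x) = mix (1 - W) x := by
  have : dev x = x - fun _ => mean x := rfl
  rw [this, mix_sub, hW.mix_one_sub_const, sub_zero]

lemma spectralGap_le_one (W : Matrix (Fin n) (Fin n) ℝ) : spectralGap W ≤ 1 := by
  have := specNorm_nonneg (W - averaging n)
  unfold spectralGap; linarith

/-- The averaging matrix annihilates zero-sum stacks, so W acts on them as W - H. -/
lemma stackNorm_mix_le_of_sum_eq_zero {x : Fin n → Vec d} (hx : ∑ i, x i = 0) :
    stackNorm (mix W x) ≤ (1 - spectralGap W) * stackNorm x := by
  have h : mix W x = mix (W - averaging n) x := by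
    ext1 i
    simp [mix, sub_smul, averaging, ← Finset.smul_sum, hx]
  rw [h, spectralGap, sub_sub_cancel]
  exact stackNorm_mix_le _ _

/-- A consensus step contracts the disagreement. -/
lemma stackNorm_consensus_le {x : Fin n → Vec d} (hx : ∑ i, x i = 0) {γ : ℝ} (h0 : 0 ≤ γ)
    (h1 : γ ≤ 1) :
    stackNorm (x - γ • mix (1 - W) x) ≤ (1 - γ * spectralGap W) * stackNorm x := by
  -- A consensus step is a convex combination of the identity and W; on zero-sum stacks their norms
  -- are at most 1 and 1 - δ.
  have h : x - γ • mix (1 - W) x = (1 - γ) • x + γ • mix W x := by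
    rw [mix_one_sub, smul_sub, sub_smul, one_smul]; abel
  rw [h]
  refine (stackNorm_add_le _ _).trans ?_
  rw [stackNorm_smul, stackNorm_smul, abs_of_nonneg h0, abs_of_nonneg (by linarith)]
  have := mul_le_mul_of_nonneg_left (stackNorm_mix_le_of_sum_eq_zero (W := W) hx) h0
  linarith

/-- With at least two agents the spectral gap is at most the norm of the Laplacian. -/
lemma spectralGap_le_laplacianNorm (hn : 2 ≤ n) : spectralGap W ≤ laplacianNorm W := by
  -- Any nonzero zero-sum x will do: x = (I - W)x + Wx gives 1 ≤ β + (1 - δ). Two agents are needed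
  -- for such an x to exist.
  let v : Vec 1 := EuclideanSpace.single 0 1
  have hv : ‖v‖ = 1 := by simp [v]
  let i₀ : Fin n := ⟨0, by omega⟩
  let i₁ : Fin n := ⟨1, by omega⟩
  have hne : i₀ ≠ i₁ := by simp [i₀, i₁]
  let x : Fin n → Vec 1 := Pi.single i₀ v - Pi.single i₁ v
  have hx : ∑ i, x i = 0 := by
    simp [x, Finset.sum_sub_distrib, Finset.sum_pi_single']
  have hx0 : 0 < stackNorm x := by
    refine lt_of_lt_of_le ?_ (norm_le_stackNorm x i₀)
    simp [x, hne, hv]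
  have h1 := stackNorm_mix_le_of_sum_eq_zero (W := W) hx
  have h2 := stackNorm_mix_le (1 - W) x
  have h3 : x = mix (1 - W) x + mix W x := by rw [mix_one_sub]; abel
  have h4 := stackNorm_add_le (mix (1 - W) x) (mix W x)
  rw [← h3] at h4
  unfold laplacianNorm
  nlinarith

end Network

/-! ### Projections -/

section Projection

variable {d : ℕ} {K : Set (Vec d)}

lemma proj_spec (hK : IsClosed K) (hne : K.Nonempty) (z : Vec d) :
    proj K z ∈ K ∧ ∀ y ∈ K, ‖proj K z - z‖ ^ 2 ≤ ‖y - z‖ ^ 2 := by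
  have h : ∃ x ∈ K, ∀ y ∈ K, ‖x - z‖ ^ 2 ≤ ‖y - z‖ ^ 2 := by
    obtain ⟨x, hx, hd⟩ := hK.exists_infDist_eq_dist hne z
    refine ⟨x, hx, fun y hy => ?_⟩
    have := Metric.infDist_le_dist_of_mem (x := z) hy
    rw [hd, dist_comm, dist_comm z, dist_eq_norm, dist_eq_norm] at this
    gcongr
  rw [proj, dif_pos h]
  exact h.choose_spec

lemma proj_mem (hK : IsClosed K) (hne : K.Nonempty) (z : Vec d) : proj K z ∈ K :=
  (proj_spec hK hne z).1

lemma inner_proj_le (hK : IsClosed K) (hc : Convex ℝ K) (z : Vec d) {y : Vec d} (hy : y ∈ K) :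
    inner ℝ (z - proj K z) (y - proj K z) ≤ 0 := by
  obtain ⟨hm, hmin⟩ := proj_spec hK ⟨y, hy⟩ z
  by_contra! hpos
  set p := proj K z
  have key : ∀ t : ℝ, 0 ≤ t → t ≤ 1 →
      2 * t * inner ℝ (z - p) (y - p) ≤ t ^ 2 * ‖y - p‖ ^ 2 := fun t h0 h1 => by
    have hmem : p + t • (y - p) ∈ K := hc.add_smul_sub_mem hm hy ⟨h0, h1⟩
    have h := hmin _ hmem
    have e : ‖p + t • (y - p) - z‖ ^ 2
        = ‖p - z‖ ^ 2 - 2 * t * inner ℝ (z - p) (y - p) + t ^ 2 * ‖y - p‖ ^ 2 := by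
      have : p + t • (y - p) - z = t • (y - p) - (z - p) := by abel
      rw [this, norm_sub_sq_real, norm_smul, mul_pow, Real.norm_eq_abs, sq_abs,
        real_inner_smul_left, real_inner_comm, norm_sub_rev z p]
      ring
    linarith
  set a := inner ℝ (z - p) (y - p)
  have h1 := key 1 zero_le_one le_rfl
  have hB : 0 < ‖y - p‖ ^ 2 := by nlinarith
  -- This t minimises the squared distance to z along the segment; t ≤ 1 follows from the case t =
  -- 1.
  have h2 := key (a / ‖y - p‖ ^ 2) (by positivity) (by rw [div_le_one hB]; nlinarith)
  have h3 : (a / ‖y - p‖ ^ 2) ^ 2 * ‖y - p‖ ^ 2 = (a / ‖y - p‖ ^ 2) * a := by field_simp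
  rw [h3] at h2
  have h4 : 0 < a / ‖y - p‖ ^ 2 * a := by positivity
  linarith

lemma norm_proj_sub_proj_le (hK : IsClosed K) (hc : Convex ℝ K) (hne : K.Nonempty) (y z : Vec d) :
    ‖proj K y - proj K z‖ ≤ ‖y - z‖ := by
  have h1 := inner_proj_le hK hc y (proj_mem hK hne z)
  have h2 := inner_proj_le hK hc z (proj_mem hK hne y)
  set p := proj K y
  set q := proj K z
  have h3 : ‖p - q‖ ^ 2 ≤ inner ℝ (y - z) (p - q) := by
    rw [← real_inner_self_eq_norm_sq]
    have e1 : inner ℝ (y - z) (p - q) - inner ℝ (p - q) (p - q)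
        = -(inner ℝ (y - p) (q - p)) - inner ℝ (z - q) (p - q) := by
      rw [← neg_sub p q, inner_neg_right, neg_neg, ← inner_sub_left, ← inner_sub_left]
      congr 1; abel
    linarith
  have h4 := real_inner_le_norm (y - z) (p - q)
  by_contra! h
  nlinarith [norm_nonneg (y - z), norm_nonneg (p - q)]

lemma proj_eq_self (hK : IsClosed K) {y : Vec d} (hy : y ∈ K) : proj K y = y := by
  have h := (proj_spec hK ⟨y, hy⟩ y).2 y hy
  rw [sub_self, norm_zero] at h
  have : ‖proj K y - y‖ = 0 := by nlinarith [norm_nonneg (proj K y - y)]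
  rwa [norm_eq_zero, sub_eq_zero] at this

lemma continuous_proj (hK : IsClosed K) (hc : Convex ℝ K) (hne : K.Nonempty) :
    Continuous (proj K) :=
  (LipschitzWith.of_dist_le_mul (K := 1) fun y z => by
    simpa [dist_eq_norm] using norm_proj_sub_proj_le hK hc hne y z).continuous

/-- Projecting the blocks onto a convex set does not increase their disagreement. -/
lemma stackNorm_dev_proj_le {n : ℕ} (hn : n ≠ 0) (hK : IsClosed K) (hc : Convex ℝ K)
    (hne : K.Nonempty) (y : Fin n → Vec d) :
    stackNorm (dev fun i => proj K (y i)) ≤ stackNorm (dev y) := by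
  -- The mean of the projections is the best centre, so it may be replaced by the projected mean;
  -- nonexpansiveness finishes.
  refine (stackNorm_dev_le_sub_const hn _ (proj K (mean y))).trans (stackNorm_mono ?_)
  gcongr with i
  exact norm_proj_sub_proj_le hK hc hne _ _

end Projection

section Shrink

variable {d : ℕ} {X : Set (Vec d)} {Rlo Rhi ε : ℝ}

lemma IsConstraintSet.zero_mem (hX : IsConstraintSet X Rlo Rhi) (h : 0 < Rlo) : (0 : Vec d) ∈ X :=
  hX.inner_ball (Metric.mem_closedBall_self h.le)

lemma IsConstraintSet.norm_le (hX : IsConstraintSet X Rlo Rhi) {x : Vec d} (hx : x ∈ X) :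
    ‖x‖ ≤ Rhi := by
  simpa using hX.outer_ball hx

lemma isClosed_shrink (hX : IsClosed X) (hε : ε < 1) : IsClosed (shrink X ε) := by
  exact (Homeomorph.smulOfNeZero (1 - ε) (by linarith)).isClosedMap _ hX

lemma convex_shrink (hX : Convex ℝ X) : Convex ℝ (shrink X ε) := hX.smul (1 - ε)

lemma zero_mem_shrink (h : (0 : Vec d) ∈ X) : (0 : Vec d) ∈ shrink X ε := ⟨0, h, by simp⟩

lemma shrink_subset (hX : Convex ℝ X) (h : (0 : Vec d) ∈ X) (h0 : 0 ≤ ε) (h1 : ε ≤ 1) :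
    shrink X ε ⊆ X := by
  rintro _ ⟨x, hx, rfl⟩
  exact hX.smul_mem_of_zero_mem h hx ⟨by linarith, by linarith⟩

/-- Query points around the shrunk set stay in the constraint set. -/
lemma IsConstraintSet.add_mem (hX : IsConstraintSet X Rlo Rhi) (h0 : 0 < ε)
    (h1 : ε ≤ 1) {x v : Vec d} (hx : x ∈ shrink X ε) (hv : ‖v‖ ≤ ε * Rlo) : x + v ∈ X := by
  obtain ⟨y, hy, rfl⟩ := hx
  have hz : ε⁻¹ • v ∈ X := by
    apply hX.inner_ball
    rw [mem_closedBall_zero_iff, norm_smul, Real.norm_eq_abs, abs_of_pos (inv_pos.2 h0),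
      inv_mul_le_iff₀ h0]
    exact hv
  have := hX.convex hy hz (by linarith : 0 ≤ 1 - ε) h0.le (by ring)
  rwa [smul_smul, mul_inv_cancel₀ h0.ne', one_smul] at this

end Shrink

/-! ### First-order inequalities for convex functions with Lipschitz gradient -/

section FirstOrder

variable {d : ℕ} {X : Set (Vec d)} {f : Vec d → ℝ} {L : ℝ}

/-- Mean value inequality along the segment for f minus its linearisation at x. The sharp factor 1/2
is not needed. -/
lemma abs_sub_sub_inner_gradientWithin_le (hX : Convex ℝ X) (hL0 : 0 ≤ L)
    (hd : DifferentiableOn ℝ f X)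
    (hL : ∀ x ∈ X, ∀ y ∈ X, ‖gradientWithin f X x - gradientWithin f X y‖ ≤ L * ‖x - y‖)
    {x y : Vec d} (hx : x ∈ X) (hy : y ∈ X) :
    |f y - f x - inner ℝ (gradientWithin f X x) (y - x)| ≤ L * ‖y - x‖ ^ 2 := by
  have hs : segment ℝ x y ⊆ X := hX.segment_subset hx hy
  have h := Convex.norm_image_sub_le_of_norm_hasFDerivWithin_le' (s := segment ℝ x y)
    (f := f) (f' := fun z => fderivWithin ℝ f X z) (φ := fderivWithin ℝ f X x)
    (C := L * ‖y - x‖) (fun z hz => ((hd z (hs hz)).hasFDerivWithinAt).mono hs)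
    (fun z hz => ?_) (convex_segment x y) (left_mem_segment ℝ x y) (right_mem_segment ℝ x y)
  · rw [inner_gradientWithin_left, sq, ← mul_assoc]
    exact h
  · have e : ‖fderivWithin ℝ f X z - fderivWithin ℝ f X x‖
        = ‖gradientWithin f X z - gradientWithin f X x‖ := by
      rw [← toDual_gradientWithin, ← toDual_gradientWithin, ← map_sub, LinearIsometryEquiv.norm_map]
    rw [e]
    refine (hL z (hs hz) x hx).trans ?_
    gcongr
    obtain ⟨t, ⟨ht0, ht1⟩, rfl⟩ := (segment_eq_image' ℝ x y).subset hz
    rw [add_sub_cancel_left, norm_smul, Real.norm_eq_abs, abs_of_nonneg ht0]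
    exact mul_le_of_le_one_left (norm_nonneg _) ht1

/-- Convexity at x + t(y - x), the quadratic remainder bound and division by t leave an error t L ‖y
- x‖², which is negligible for small t. This works at boundary points too. -/
lemma add_inner_gradientWithin_le (hf : ConvexOn ℝ X f) (hL0 : 0 ≤ L)
    (hd : DifferentiableOn ℝ f X)
    (hL : ∀ x ∈ X, ∀ y ∈ X, ‖gradientWithin f X x - gradientWithin f X y‖ ≤ L * ‖x - y‖)
    {x y : Vec d} (hx : x ∈ X) (hy : y ∈ X) :
    f x + inner ℝ (gradientWithin f X x) (y - x) ≤ f y := by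
  have key : ∀ t : ℝ, 0 < t → t ≤ 1 →
      f x + inner ℝ (gradientWithin f X x) (y - x) - f y ≤ t * (L * ‖y - x‖ ^ 2) := by
    intro t h0 h1
    have hmem : x + t • (y - x) ∈ X := hf.1.add_smul_sub_mem hx hy ⟨h0.le, h1⟩
    have h2 := (abs_le.1 (abs_sub_sub_inner_gradientWithin_le hf.1 hL0 hd hL hx hmem)).1
    have h3 := hf.2 hx hy (by linarith : 0 ≤ 1 - t) h0.le (by ring)
    have e : (1 - t) • x + t • y = x + t • (y - x) := by
      rw [sub_smul, one_smul, smul_sub]; abel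
    rw [e, smul_eq_mul, smul_eq_mul] at h3
    rw [add_sub_cancel_left, inner_smul_right, norm_smul, mul_pow, Real.norm_eq_abs, sq_abs] at h2
    have h4 : t * (f x + inner ℝ (gradientWithin f X x) (y - x) - f y)
        ≤ t * (t * (L * ‖y - x‖ ^ 2)) := by nlinarith
    exact le_of_mul_le_mul_left h4 h0
  by_contra! h
  set g := f x + inner ℝ (gradientWithin f X x) (y - x) - f y with hg
  have hg0 : 0 < g := by linarith
  have hB : 0 ≤ L * ‖y - x‖ ^ 2 := by positivity
  set B := L * ‖y - x‖ ^ 2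
  have h1 := key 1 one_pos le_rfl
  have hBp : 0 < B := by linarith
  have h2 := key (g / (2 * B)) (by positivity) (by rw [div_le_one (by positivity)]; linarith)
  have h3 : g / (2 * B) * B = g / 2 := by field_simp
  linarith

end FirstOrder

/-! ### The uniform distribution on the sphere -/

section Sphere

variable {d : ℕ}

lemma ae_norm_eq_one_sphereUniform : ∀ᵐ u ∂(sphereUniform d), ‖u‖ = 1 := by
  rw [sphereUniform, ae_map_iff measurable_subtype_coe.aemeasurable
    (measurableSet_eq_fun measurable_norm measurable_const)]
  exact Filter.Eventually.of_forall fun u => by simp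

open scoped Pointwise in
-- The surface measure of a set is a multiple of the volume of the cone over it; linear isometries
-- commute with forming cones and preserve volume.
lemma map_toSphere_isometry (A : Vec d ≃ₗᵢ[ℝ] Vec d) :
    (((volume : Measure (Vec d)).toSphere).map Subtype.val).map A
      = ((volume : Measure (Vec d)).toSphere).map Subtype.val := by
  ext s hs
  have hA : Measurable A := A.continuous.measurable
  rw [Measure.map_apply hA hs, Measure.map_apply measurable_subtype_coe (hA hs),
    Measure.map_apply measurable_subtype_coe hs,
    Measure.toSphere_apply' _ (measurable_subtype_coe (hA hs)),
    Measure.toSphere_apply' _ (measurable_subtype_coe hs),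
    Subtype.image_preimage_coe, Subtype.image_preimage_coe]
  congr 1
  have hset : Set.Ioo (0 : ℝ) 1 • (Metric.sphere (0 : Vec d) 1 ∩ A ⁻¹' s)
      = A ⁻¹' (Set.Ioo (0 : ℝ) 1 • (Metric.sphere (0 : Vec d) 1 ∩ s)) := by
    ext x
    simp only [Set.mem_smul, Set.mem_inter_iff, Set.mem_preimage, mem_sphere_zero_iff_norm]
    constructor
    · rintro ⟨t, ht, y, ⟨hy, hys⟩, rfl⟩
      exact ⟨t, ht, A y, ⟨by rw [A.norm_map, hy], hys⟩, by simp⟩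
    · rintro ⟨t, ht, y, ⟨hy, hys⟩, he⟩
      refine ⟨t, ht, A.symm y, ⟨by rw [A.symm.norm_map, hy], by simpa using hys⟩, ?_⟩
      apply A.injective
      rw [map_smul, A.apply_symm_apply, he]
  rw [hset]
  exact (A.measurePreserving).measure_preimage_emb A.toMeasurableEquiv.measurableEmbedding _

lemma map_sphereUniform_isometry (A : Vec d ≃ₗᵢ[ℝ] Vec d) :
    (sphereUniform d).map A = sphereUniform d := by
  rw [sphereUniform, Measure.map_smul, Measure.map_smul, map_toSphere_isometry]

lemma isProbabilityMeasure_sphereUniform (hd : 0 < d) :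
    IsProbabilityMeasure (sphereUniform d) := by
  have : Nonempty (Fin d) := ⟨⟨0, hd⟩⟩
  have : Nontrivial (Vec d) := inferInstance
  refine ⟨?_⟩
  rw [sphereUniform, Measure.map_apply measurable_subtype_coe MeasurableSet.univ,
    Set.preimage_univ, Measure.smul_apply, smul_eq_mul]
  refine ENNReal.inv_mul_cancel ?_ (measure_ne_top _ _)
  rw [Ne, Measure.measure_univ_eq_zero]
  exact Measure.toSphere_ne_zero _

lemma integrable_inner_mul_inner_sphereUniform (hd : 0 < d) (v w : Vec d) :
    Integrable (fun u => inner ℝ v u * inner ℝ w u) (sphereUniform d) := by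
  have := isProbabilityMeasure_sphereUniform hd
  refine Integrable.of_bound
    (by fun_prop : Continuous fun u => inner ℝ v u * inner ℝ w u).aestronglyMeasurable
    (‖v‖ * ‖w‖) ?_
  filter_upwards [ae_norm_eq_one_sphereUniform] with u hu
  rw [norm_mul]
  gcongr
  · simpa [hu] using norm_inner_le_norm (𝕜 := ℝ) v u
  · simpa [hu] using norm_inner_le_norm (𝕜 := ℝ) w u

/-- The reflection in the hyperplane orthogonal to v - w exchanges the two vectors and preserves the
distribution. -/
lemma integral_inner_sq_sphereUniform_eq {v w : Vec d} (h : ‖v‖ = ‖w‖) :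
    ∫ u, inner ℝ v u ^ 2 ∂(sphereUniform d) = ∫ u, inner ℝ w u ^ 2 ∂(sphereUniform d) := by
  set A := Submodule.reflection (ℝ ∙ (v - w))ᗮ
  have hA : A v = w := Submodule.reflection_sub h
  conv_rhs => rw [← map_sphereUniform_isometry A]
  rw [integral_map A.continuous.measurable.aemeasurable
    (by fun_prop : Continuous fun u => inner ℝ w u ^ 2).aestronglyMeasurable]
  simp_rw [← hA, A.inner_map_map]

lemma integral_inner_sq_sphereUniform (hd : 0 < d) (v : Vec d) :
    ∫ u, inner ℝ v u ^ 2 ∂(sphereUniform d) = ‖v‖ ^ 2 / d := by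
  have := isProbabilityMeasure_sphereUniform hd
  have hd' : (d : ℝ) ≠ 0 := by positivity
  let e : Fin d → Vec d := fun i => EuclideanSpace.single i 1
  have h1 : ∀ i, ∫ u, inner ℝ (‖v‖ • e i) u ^ 2 ∂(sphereUniform d)
      = ∫ u, inner ℝ v u ^ 2 ∂(sphereUniform d) := fun i =>
    integral_inner_sq_sphereUniform_eq (by simp [e, norm_smul])
  -- The d scaled basis vectors have equal second moments, and these add up to ‖v‖² because ‖u‖ = 1.
  have h2 : ∑ i, ∫ u, inner ℝ (‖v‖ • e i) u ^ 2 ∂(sphereUniform d) = ‖v‖ ^ 2 := by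
    rw [← integral_finsetSum _ fun i _ => by
      simpa only [sq] using integrable_inner_mul_inner_sphereUniform hd (‖v‖ • e i) (‖v‖ • e i)]
    have : ∀ᵐ u ∂(sphereUniform d), ∑ i, inner ℝ (‖v‖ • e i) u ^ 2 = ‖v‖ ^ 2 := by
      filter_upwards [ae_norm_eq_one_sphereUniform] with u hu
      have h3 : ∑ i, u i ^ 2 = 1 := by
        have := EuclideanSpace.norm_sq_eq u
        rw [hu] at this
        simpa using this.symm
      simp only [real_inner_smul_left, mul_pow, ← Finset.mul_sum, e]
      simp [EuclideanSpace.inner_single_left, h3]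
    rw [integral_congr_ae this]
    simp
  simp_rw [h1] at h2
  rw [Finset.sum_const, Finset.card_univ, Fintype.card_fin, nsmul_eq_mul] at h2
  field_simp
  linarith

/-- A uniform direction `u` has second moment `𝔼 u uᵀ = I / d`. -/
lemma integral_inner_mul_inner_sphereUniform (hd : 0 < d) (v w : Vec d) :
    ∫ u, inner ℝ v u * inner ℝ w u ∂(sphereUniform d) = inner ℝ v w / d := by
  have hi := integrable_inner_mul_inner_sphereUniform hd (d := d)
  have h : ∀ u, inner ℝ v u * inner ℝ w u
      = (inner ℝ (v + w) u ^ 2 - inner ℝ (v - w) u ^ 2) / 4 := fun u => by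
    rw [inner_add_left, inner_sub_left]; ring
  simp_rw [h]
  rw [integral_div, integral_sub (by simpa only [sq] using hi _ _)
    (by simpa only [sq] using hi _ _), integral_inner_sq_sphereUniform hd,
    integral_inner_sq_sphereUniform hd, norm_add_sq_real, norm_sub_sq_real]
  ring

end Sphere

/-! ### The gradient estimator -/

section Estimator

variable {n d : ℕ} {Ξ : Type*} [MeasurableSpace Ξ] {X : Set (Vec d)} {F : Fin n → Vec d → Ξ → ℝ}
  {P : Fin n → Measure Ξ} {Lf Lm σ Rlo Rhi ε μ : ℝ}

omit [MeasurableSpace Ξ] in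
-- Both query points see the same sample, so the Lipschitz bound cancels the factor 1/μ.
lemma norm_gradEst_le {f : Vec d → Ξ → ℝ} (hμ : 0 < μ) {x u : Vec d} {z : Ξ} (hu : ‖u‖ = 1)
    (hx : x ∈ X) (hxu : x + μ • u ∈ X)
    (hf : ∀ x ∈ X, ∀ y ∈ X, |f x z - f y z| ≤ Lf * ‖x - y‖) :
    ‖gradEst f μ x u z‖ ≤ d * Lf := by
  have h := hf _ hxu _ hx
  rw [add_sub_cancel_left, norm_smul, hu, Real.norm_eq_abs, abs_of_pos hμ, mul_one] at h
  rw [gradEst, norm_smul, norm_smul, hu, mul_one, Real.norm_eq_abs, Real.norm_eq_abs,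
    abs_of_nonneg (by positivity)]
  calc (d : ℝ) / μ * |f (x + μ • u) z - f x z| ≤ d / μ * (Lf * μ) := by gcongr
    _ = d * Lf := by field_simp

lemma Measurable.gradEst {A : Type*} [MeasurableSpace A] {f : Vec d → Ξ → ℝ}
    (hf : Measurable (Function.uncurry f)) (μ : ℝ) {x u : A → Vec d} {z : A → Ξ}
    (hx : Measurable x) (hu : Measurable u) (hz : Measurable z) :
    Measurable fun a => ComDSZO.gradEst f μ (x a) (u a) (z a) := by
  have h1 : Measurable fun a => f (x a + μ • u a) (z a) :=
    hf.comp ((hx.add (hu.const_smul μ)).prodMk hz)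
  have h2 : Measurable fun a => f (x a) (z a) := hf.comp (hx.prodMk hz)
  unfold ComDSZO.gradEst
  exact ((h1.sub h2).smul hu).const_smul ((d : ℝ) / μ)

lemma IsSmoothProblem.convexOn_localLoss (hF : IsSmoothProblem X F P Lf Lm σ) (hX : Convex ℝ X)
    (i : Fin n) : ConvexOn ℝ X (localLoss F P i) := by
  refine ⟨hX, fun x hx y hy a b ha hb hab => ?_⟩
  simp only [localLoss, smul_eq_mul]
  rw [← integral_const_mul, ← integral_const_mul,
    ← integral_add ((hF.integrable i x hx).const_mul _)
    ((hF.integrable i y hy).const_mul _)]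
  refine integral_mono_ae (hF.integrable i _ (hX hx hy ha hb hab))
    (((hF.integrable i x hx).const_mul _).add ((hF.integrable i y hy).const_mul _)) ?_
  filter_upwards [hF.convex i] with z hz
  exact hz.2 hx hy ha hb hab

variable [∀ i, IsProbabilityMeasure (P i)]

lemma IsSmoothProblem.abs_localLoss_sub_le (hF : IsSmoothProblem X F P Lf Lm σ)
    (i : Fin n) {x y : Vec d} (hx : x ∈ X) (hy : y ∈ X) :
    |localLoss F P i x - localLoss F P i y| ≤ Lf * ‖x - y‖ := by
  rw [localLoss, localLoss, ← integral_sub (hF.integrable i x hx) (hF.integrable i y hy)]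
  have := norm_integral_le_of_norm_le_const (μ := P i) (C := Lf * ‖x - y‖)
    (f := fun z => F i x z - F i y z) (by
      filter_upwards [hF.lipschitz i] with z hz
      exact hz x hx y hy)
  simpa using this

lemma IsSmoothProblem.abs_globalLoss_sub_le (hF : IsSmoothProblem X F P Lf Lm σ) (hn : n ≠ 0)
    {x y : Vec d} (hx : x ∈ X) (hy : y ∈ X) :
    |globalLoss F P x - globalLoss F P y| ≤ Lf * ‖x - y‖ := by
  have hn' : (0 : ℝ) < n := by positivity
  rw [globalLoss, globalLoss, ← mul_sub, ← Finset.sum_sub_distrib, abs_mul,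
    abs_of_pos (by positivity : (0 : ℝ) < 1 / n), one_div, inv_mul_le_iff₀ hn']
  calc _ ≤ ∑ i, |localLoss F P i x - localLoss F P i y| := Finset.abs_sum_le_sum_abs _ _
    _ ≤ ∑ _i : Fin n, Lf * ‖x - y‖ := by
        gcongr with i; exact hF.abs_localLoss_sub_le i hx hy
    _ = n * (Lf * ‖x - y‖) := by simp

lemma IsSmoothProblem.measurable_globalLoss (hF : IsSmoothProblem X F P Lf Lm σ) :
    Measurable (globalLoss F P) := by
  unfold globalLoss localLoss
  refine (Finset.measurable_sum _ fun i _ => ?_).const_mul _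
  exact ((hF.measurable i).stronglyMeasurable.integral_prod_right).measurable

/-- The gradient estimator is nearly unbiased. -/
lemma IsSmoothProblem.inner_gradEst_ge (hF : IsSmoothProblem X F P Lf Lm σ)
    (hX : IsConstraintSet X Rlo Rhi) (hd : 0 < d) (hLm : 0 ≤ Lm)
    (hμ : 0 < μ) (hε0 : 0 < ε) (hε : ε < 1) (hRlo : 0 < Rlo) (hμε : μ ≤ ε * Rlo) (i : Fin n)
    {x y : Vec d} (hx : x ∈ shrink X ε) (hy : y ∈ X) :
    localLoss F P i x - localLoss F P i y - d * Lm * μ * ‖x - y‖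
      ≤ ∫ p, inner ℝ (x - y) (gradEst (F i) μ x p.1 p.2) ∂((sphereUniform d).prod (P i)) := by
  have := isProbabilityMeasure_sphereUniform hd
  have hd' : (0 : ℝ) < d := by positivity
  have h0X := hX.zero_mem hRlo
  have hxX : x ∈ X := shrink_subset hX.convex h0X hε0.le hε.le hx
  have hq : ∀ u : Vec d, ‖u‖ = 1 → x + μ • u ∈ X := fun u hu =>
    hX.add_mem hε0 hε.le hx (by rw [norm_smul, hu, Real.norm_eq_abs, abs_of_pos hμ]; linarith)
  set v := x - y with hv
  set f := localLoss F P i with hf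
  set G := gradientWithin f X x with hG
  have hmeas : Measurable fun p : Vec d × Ξ => inner ℝ v (gradEst (F i) μ x p.1 p.2) :=
    measurable_const.inner (Measurable.gradEst (hF.measurable i) μ measurable_const measurable_fst
      measurable_snd)
  have hint : Integrable (fun p : Vec d × Ξ => inner ℝ v (gradEst (F i) μ x p.1 p.2))
      ((sphereUniform d).prod (P i)) := by
    have hae := hmeas.aestronglyMeasurable (μ := (sphereUniform d).prod (P i))
    refine Integrable.of_bound hae (‖v‖ * (d * Lf)) ?_
    have h1 : ∀ᵐ p ∂((sphereUniform d).prod (P i)), ‖p.1‖ = 1 :=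
      Measure.quasiMeasurePreserving_fst.ae ae_norm_eq_one_sphereUniform
    have h2 := Measure.quasiMeasurePreserving_snd (μ := sphereUniform d) |>.ae (hF.lipschitz i)
    filter_upwards [h1, h2] with p hp1 hp2
    have h3 := norm_inner_le_norm (𝕜 := ℝ) v (gradEst (F i) μ x p.1 p.2)
    have h4 : ‖gradEst (F i) μ x p.1 p.2‖ ≤ d * Lf :=
      norm_gradEst_le (f := F i) hμ hp1 hxX (hq _ hp1) hp2
    exact h3.trans (by gcongr)
  have hinner : ∀ᵐ u ∂(sphereUniform d),
      ∫ z, inner ℝ v (gradEst (F i) μ x u z) ∂(P i)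
        = d / μ * ((f (x + μ • u) - f x) * inner ℝ v u) := by
    filter_upwards [ae_norm_eq_one_sphereUniform] with u hu
    have e : ∀ z, inner ℝ v (gradEst (F i) μ x u z)
        = (d / μ * inner ℝ v u) * (F i (x + μ • u) z - F i x z) := fun z => by
      rw [gradEst, real_inner_smul_right, real_inner_smul_right]; ring
    simp_rw [e]
    rw [integral_const_mul, integral_sub (hF.integrable i _ (hq u hu)) (hF.integrable i _ hxX)]
    simp only [hf, localLoss]
    ring
  -- Linearising f at x costs Lm μ² per query, hence d Lm μ ‖v‖ after the factor d/μ. The main term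
  -- has mean ⟨G, v⟩ by the second moment I/d.
  have hlow : ∀ᵐ u ∂(sphereUniform d),
      d * (inner ℝ G u * inner ℝ v u) - d * Lm * μ * ‖v‖
        ≤ ∫ z, inner ℝ v (gradEst (F i) μ x u z) ∂(P i) := by
    filter_upwards [hinner, ae_norm_eq_one_sphereUniform] with u h hu
    rw [h]
    have h1 := abs_sub_sub_inner_gradientWithin_le hX.convex hLm (hF.differentiable i)
      (hF.smooth i) hxX (hq u hu)
    rw [add_sub_cancel_left, norm_smul, hu, Real.norm_eq_abs, abs_of_pos hμ, mul_one,
      real_inner_smul_right] at h1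
    have h2 : |inner ℝ v u| ≤ ‖v‖ := by simpa [hu] using abs_real_inner_le_norm v u
    have h3 : |(f (x + μ • u) - f x - μ * inner ℝ G u) * inner ℝ v u| ≤ Lm * μ ^ 2 * ‖v‖ := by
      rw [abs_mul]; gcongr
    have h4 := (abs_le.1 h3).1
    have h5 : (d : ℝ) / μ * (-(Lm * μ ^ 2 * ‖v‖))
        ≤ d / μ * ((f (x + μ • u) - f x - μ * inner ℝ G u) * inner ℝ v u) := by gcongr
    have h6 : (d : ℝ) / μ * (-(Lm * μ ^ 2 * ‖v‖)) = - (d * Lm * μ * ‖v‖) := by field_simp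
    have h7 : (d : ℝ) / μ * ((f (x + μ • u) - f x - μ * inner ℝ G u) * inner ℝ v u)
        = d / μ * ((f (x + μ • u) - f x) * inner ℝ v u) - d * (inner ℝ G u * inner ℝ v u) := by
      field_simp
    linarith
  rw [integral_prod _ hint]
  have hmono := integral_mono_ae
    (((integrable_inner_mul_inner_sphereUniform hd G v).const_mul (d : ℝ)).sub
      (integrable_const (d * Lm * μ * ‖v‖))) hint.integral_prod_left hlow
  rw [integral_sub' ((integrable_inner_mul_inner_sphereUniform hd G v).const_mul (d : ℝ))
    (integrable_const _), integral_const_mul, integral_inner_mul_inner_sphereUniform hd,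
    integral_const, probReal_univ, one_smul, mul_div_cancel₀ _ hd'.ne'] at hmono
  refine le_trans ?_ hmono
  have hconv := add_inner_gradientWithin_le (hF.convexOn_localLoss hX.convex i) hLm
    (hF.differentiable i) (hF.smooth i) hxX hy
  have : inner ℝ G (y - x) = - inner ℝ G v := by rw [hv, ← inner_neg_right, neg_sub]
  linarith

end Estimator

/-! ### Weighted sums -/

section Sequences

/-- The weights `√(k + c)`, proportional to the inverse step sizes. -/
noncomputable def weight (c : ℝ) (k : ℕ) : ℝ := Real.sqrt (k + c)

variable {c : ℝ} (hc : 4 < c)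
include hc

lemma weight_sq (k : ℕ) : weight c k ^ 2 = k + c := by
  rw [weight, Real.sq_sqrt (by positivity)]

lemma one_le_weight (k : ℕ) : 1 ≤ weight c k := by
  rw [weight, Real.one_le_sqrt]
  have : (0 : ℝ) ≤ k := by positivity
  linarith

omit hc in
lemma weight_le_succ (k : ℕ) : weight c k ≤ weight c (k + 1) := by
  unfold weight; gcongr; simp

/-- The squared weights increase by exactly 1, and consecutive weights differ by a factor at most 2;
this makes sums of inverse weights telescope. -/
lemma inv_weight_le (k : ℕ) : 1 / weight c k ≤ 3 * (weight c (k + 1) - weight c k) := by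
  have h1 := weight_sq hc k
  have h2 := weight_sq hc (k + 1)
  have h3 := one_le_weight hc k
  have h4 : weight c k ≤ weight c (k + 1) := weight_le_succ k
  push_cast at h2
  rw [div_le_iff₀ (by linarith)]
  have h5 : (weight c (k + 1) - weight c k) * (weight c (k + 1) + weight c k) = 1 := by
    linear_combination h2 - h1
  have h6 : weight c (k + 1) ≤ 2 * weight c k := by
    have : (0 : ℝ) ≤ k := by positivity
    nlinarith
  nlinarith

lemma inv_weight_succ_le (k : ℕ) :
    1 / weight c (k + 1) ≤ 2 * (weight c (k + 1) - weight c k) := by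
  have h1 := weight_sq hc k
  have h2 := weight_sq hc (k + 1)
  have h3 := one_le_weight hc (k + 1)
  have h4 : weight c k ≤ weight c (k + 1) := weight_le_succ k
  push_cast at h2
  rw [div_le_iff₀ (by linarith)]
  nlinarith

lemma sum_inv_weight_le (T : ℕ) : ∑ k ∈ Finset.Icc 1 T, 1 / weight c k ≤ 2 * weight c T := by
  induction T with
  | zero =>
    have := one_le_weight hc 0
    simp only [zero_lt_one, Finset.Icc_eq_empty_of_lt, Finset.sum_empty]
    linarith
  | succ T ih =>
    rw [Finset.sum_Icc_succ_top (by omega)]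
    linarith [inv_weight_succ_le hc T]

/-- Summation by parts: the weights increase, so each increment is charged at most `Dmax`. -/
lemma sum_weight_mul_sub_le {D : ℕ → ℝ} {Dmax : ℝ} (h0 : ∀ k, 1 ≤ k → 0 ≤ D k)
    (hD : ∀ k, 1 ≤ k → D k ≤ Dmax) (T : ℕ) :
    ∑ k ∈ Finset.Icc 1 T, weight c k * (D k - D (k + 1)) ≤ weight c T * Dmax := by
  have key : ∑ k ∈ Finset.Icc 1 T, weight c k * (D k - D (k + 1))
      ≤ weight c T * Dmax - weight c T * D (T + 1) := by
    induction T with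
    | zero =>
      have := mul_le_mul_of_nonneg_left (hD 1 le_rfl) (by linarith [one_le_weight hc 0] :
        0 ≤ weight c 0)
      simpa using this
    | succ T ih =>
      rw [Finset.sum_Icc_succ_top (by omega)]
      have h1 := mul_le_mul_of_nonneg_left (hD (T + 1) (by omega))
        (sub_nonneg.2 (weight_le_succ (c := c) T))
      linarith
  have := mul_nonneg (zero_le_one.trans (one_le_weight hc T)) (h0 (T + 1) (by omega))
  linarith

/-- A perturbed contraction with perturbations `B / √(k + c)` has small weighted energy. -/
lemma sum_weight_mul_sq_le {V : ℕ → ℝ} {l B V₁ : ℝ} (hl0 : 0 ≤ l) (hl1 : l < 1)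
    (hV0 : ∀ k, 1 ≤ k → 0 ≤ V k) (hV1 : V 1 ≤ V₁)
    (hV : ∀ k, 1 ≤ k → V (k + 1) ≤ l * V k + B / weight c k) {T : ℕ} (hT : 1 ≤ T) :
    ∑ k ∈ Finset.Icc 1 T, weight c k * V k ^ 2
      ≤ (V₁ ^ 2 + B ^ 2 / (1 - l) / (1 - l) + 3 * (B ^ 2 / (1 - l))) / (1 - l) * weight c T := by
  have hl : 0 < 1 - l := by linarith
  set A := B ^ 2 / (1 - l) with hA
  have hA0 : 0 ≤ A := by positivity
  have hw : ∀ k, 0 < weight c k := fun k => by linarith [one_le_weight hc k]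
  -- Convexity of the square, with l V + B/w read as the average of V and B/(w(1-l)) with weights l
  -- and 1 - l.
  have hU : ∀ k, 1 ≤ k → V (k + 1) ^ 2 ≤ l * V k ^ 2 + A / weight c k ^ 2 := fun k hk => by
    have h1 : V (k + 1) ^ 2 ≤ (l * V k + B / weight c k) ^ 2 :=
      pow_le_pow_left₀ (hV0 _ (by omega)) (hV k hk) 2
    have h2 : l * V k ^ 2 + A / weight c k ^ 2 - (l * V k + B / weight c k) ^ 2
        = l * (1 - l) * (V k - B / weight c k / (1 - l)) ^ 2 := by
      have := (hw k).ne'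
      rw [hA]; field_simp; ring
    have h3 : 0 ≤ l * (1 - l) * (V k - B / weight c k / (1 - l)) ^ 2 := by positivity
    linarith
  have hM : ∀ k, 1 ≤ k → V k ^ 2 ≤ V₁ ^ 2 + A / (1 - l) := by
    intro k hk
    induction k, hk using Nat.le_induction with
    | base =>
      have : V 1 ^ 2 ≤ V₁ ^ 2 := pow_le_pow_left₀ (hV0 1 le_rfl) hV1 2
      have : 0 ≤ A / (1 - l) := by positivity
      linarith
    | succ k hk ih =>
      have h1 : A / weight c k ^ 2 ≤ A :=
        div_le_self hA0 (one_le_pow₀ (one_le_weight hc k))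
      have h2 : A = (1 - l) * (A / (1 - l)) := by field_simp
      nlinarith [hU k hk, sq_nonneg V₁]
  set M := V₁ ^ 2 + A / (1 - l)
  -- The extra last term makes the induction close: in the next step it absorbs the l V² part of the
  -- bound on the new square. The weight increment is paid by the uniform bound M, and A/w by
  -- telescoping.
  have key : (1 - l) * ∑ k ∈ Finset.Icc 1 T, weight c k * V k ^ 2 + l * (weight c T * V T ^ 2)
      ≤ (M + 3 * A) * weight c T := by
    induction T, hT using Nat.le_induction with
    | base =>
      have h1 := mul_le_mul_of_nonneg_left (hM 1 le_rfl) (hw 1).le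
      have h2 : 0 ≤ A * weight c 1 := mul_nonneg hA0 (hw 1).le
      simp only [Finset.Icc_self, Finset.sum_singleton]
      linarith
    | succ T hT ih =>
      rw [Finset.sum_Icc_succ_top (by omega)]
      have h1 := mul_le_mul_of_nonneg_left (hU T hT) (hw T).le
      have h2 := mul_le_mul_of_nonneg_left (hM (T + 1) (by omega))
        (sub_nonneg.2 (weight_le_succ (c := c) T))
      have h3 := mul_le_mul_of_nonneg_left (inv_weight_le hc T) hA0
      have h4 : weight c T * (A / weight c T ^ 2) = A * (1 / weight c T) := by
        have := (hw T).ne'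
        field_simp
      rw [mul_add, h4] at h1
      linarith
  rw [div_mul_eq_mul_div, le_div_iff₀ hl]
  have : 0 ≤ l * (weight c T * V T ^ 2) := mul_nonneg hl0 (mul_nonneg (hw T).le (sq_nonneg _))
  linarith

end Sequences

/-! ### Stability of the consensus and compression errors -/

section Stability

/-- For admissible gains the coupled consensus and compression recursion is a contraction in the
norm `a + (δ/β) p`, at a rate that does not depend on the compressor. -/
lemma coupled_contraction {δ β γ c₀ a p a' p' g : ℝ} (hγ : GammaAdmissible δ β γ c₀)
    (hc₀ : 0 < c₀) (hδ : 0 < δ) (hδ1 : δ ≤ 1) (hδβ : δ ≤ β) (ha : 0 ≤ a) (hp : 0 ≤ p)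
    (hg : 0 ≤ g)
    (ha' : a' ≤ (1 - γ * δ) * a + γ * β * p + g)
    (hp' : p' ≤ (1 - c₀) * (γ * β * a + (1 + γ * β) * p + g)) :
    a' + δ / β * p' ≤ (1 - γ * δ * (γ * β ^ 2 * (1 + 2 / δ)) / 3) * (a + δ / β * p) + 2 * g := by
  obtain ⟨h0, h1, -, h2⟩ := hγ
  have hβ : 0 < β := by linarith
  -- Only the second summand of κ₂ is needed. It bounds c₀ from below by a quantity free of the
  -- compressor.
  have hk : γ * (β ^ 2 * (1 + 2 / δ)) < c₀ := by
    have : 0 ≤ γ * ((1 + c₀⁻¹) ^ 2 * γ * β ^ 2) := by positivity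
    unfold kappa2 at h2
    linarith
  set m := γ * β ^ 2 * (1 + 2 / δ) with hm
  have hm0 : 0 < m := by positivity
  have hmc : m < c₀ := by rw [hm]; linarith
  have hmδ : m * δ = γ * β ^ 2 * (δ + 2) := by rw [hm]; field_simp
  set θ := δ / β with hθ
  have hθ0 : 0 < θ := by positivity
  have hθ1 : θ ≤ 1 := by rw [hθ, div_le_one hβ]; exact hδβ
  have hθβ : θ * β = δ := by rw [hθ]; field_simp
  have e1 : θ * p' ≤ θ * ((1 - c₀) * (γ * β * a + (1 + γ * β) * p + g)) := by gcongr
  -- The weight θ = δ/β is chosen so that the feedback of a through p is γδ(1 - c₀), leaving the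
  -- decrease γδc₀.
  have c1 : (1 - γ * δ) + θ * (1 - c₀) * (γ * β) ≤ 1 - γ * δ * m / 3 := by
    have : θ * (1 - c₀) * (γ * β) = γ * δ * (1 - c₀) := by linear_combination γ * (1 - c₀) * hθβ
    rw [this]
    have : γ * δ * (m / 3) ≤ γ * δ * c₀ := by gcongr; linarith
    linarith
  have c2 : γ * β + θ * (1 - c₀) * (1 + γ * β) ≤ (1 - γ * δ * m / 3) * θ := by
    have key : γ * β ^ 2 + (1 - c₀) * (1 + γ * β) * δ ≤ (1 - γ * δ * m / 3) * δ := by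
      have i1 : γ * β * δ ≤ γ * β * β := by gcongr
      have i2 : (1 - c₀) * (γ * β * δ) ≤ γ * β * δ := by
        have : 0 ≤ c₀ * (γ * β * δ) := by positivity
        linarith
      -- The 2 in δ + 2 pays for γβ² and for γβδ ≤ γβ²; the remaining γβ²δ pays for the contraction,
      -- the 3 in the rate coming from δ + 2 ≤ 3.
      have i3 : γ * β ^ 2 * (δ + 2) ≤ c₀ * δ := by rw [← hmδ]; gcongr
      have i4 : γ * δ * m / 3 * δ ≤ γ * β ^ 2 * δ := by
        have : γ * δ * m / 3 * δ = γ * δ * (m * δ) / 3 := by ring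
        rw [this, hmδ]
        have : γ * (δ + 2) / 3 ≤ 1 := by nlinarith
        have := mul_le_mul_of_nonneg_left this (by positivity : 0 ≤ γ * β ^ 2 * δ)
        linarith
      nlinarith
    have : γ * β + θ * (1 - c₀) * (1 + γ * β)
        = (γ * β ^ 2 + (1 - c₀) * (1 + γ * β) * δ) / β := by rw [hθ]; field_simp
    rw [this, hθ, ← mul_div_assoc]
    gcongr
  have c3 : θ * (1 - c₀) * g ≤ g := by
    have : θ * (1 - c₀) ≤ 1 := by nlinarith
    nlinarith
  have f1 := mul_le_mul_of_nonneg_right c1 ha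
  have f2 := mul_le_mul_of_nonneg_right c2 hp
  nlinarith

/-- The κ₁ condition implies γδ/4 < δ, which with γ < 1 excludes δ ≤ 0. -/
lemma GammaAdmissible.delta_pos {δ β γ c₀ : ℝ} (hγ : GammaAdmissible δ β γ c₀) : 0 < δ := by
  obtain ⟨h0, h1, h2, -⟩ := hγ
  unfold kappa1 at h2
  have h3 : 0 ≤ γ * (2 * (1 + c₀⁻¹) ^ 2 * γ * β ^ 2) := by positivity
  by_contra! h
  nlinarith

end Stability

/-! ### One step of the algorithm, pathwise -/

section Step

variable {n d : ℕ} {G : SimpleGraph (Fin n)} {W : Matrix (Fin n) (Fin n) ℝ} {K : Set (Vec d)}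
  {γ η : ℝ} {x x' e g : Fin n → Vec d}

lemma IsNetwork.stackNorm_mix_sub_le (hW : IsNetwork G W) (x e : Fin n → Vec d) :
    stackNorm (mix (1 - W) (x - e)) ≤ laplacianNorm W * (stackNorm (dev x) + stackNorm e) := by
  have h : mix (1 - W) (x - e) = mix (1 - W) (dev x - e) := by
    rw [mix_sub, mix_sub, hW.mix_one_sub_dev]
  rw [h]
  refine (stackNorm_mix_le _ _).trans ?_
  exact mul_le_mul_of_nonneg_left (stackNorm_sub_le _ _) (specNorm_nonneg _)

/-- Projection does not increase disagreement, and the consensus correction is its own deviation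
since it sums to zero. What remains is an exact consensus step perturbed by e and g. -/
lemma IsNetwork.stackNorm_dev_step_le (hW : IsNetwork G W) (hK : IsClosed K) (hc : Convex ℝ K)
    (hne : K.Nonempty) (hγ0 : 0 ≤ γ) (hγ1 : γ ≤ 1) (hη : 0 ≤ η)
    (hx' : ∀ i, x' i = proj K (x i - γ • mix (1 - W) (x - e) i - η • g i)) :
    stackNorm (dev x') ≤ (1 - γ * spectralGap W) * stackNorm (dev x)
      + γ * laplacianNorm W * stackNorm e + η * stackNorm g := by
  have hn := hW.ne_zero
  rw [funext hx']
  refine (stackNorm_dev_proj_le hn hK hc hne _).trans ?_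
  have h : dev (fun i => x i - γ • mix (1 - W) (x - e) i - η • g i)
      = (dev x - γ • mix (1 - W) (dev x)) + γ • mix (1 - W) e - η • dev g := by
    have : (fun i => x i - γ • mix (1 - W) (x - e) i - η • g i)
        = x - γ • mix (1 - W) (x - e) - η • g := rfl
    rw [this, dev_sub, dev_sub, dev_smul, dev_smul, dev_eq_of_sum_eq_zero (hW.sum_mix_one_sub _),
      mix_sub, hW.mix_one_sub_dev, smul_sub]
    abel
  rw [h]
  have h1 := stackNorm_consensus_le (W := W) (sum_dev hn x) hγ0 hγ1
  have h2 := mul_le_mul_of_nonneg_left (stackNorm_mix_le (1 - W) e) hγ0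
  have h3 := mul_le_mul_of_nonneg_left (stackNorm_dev_le hn g) hη
  have h4 := stackNorm_sub_le ((dev x - γ • mix (1 - W) (dev x)) + γ • mix (1 - W) e) (η • dev g)
  have h5 := stackNorm_add_le (dev x - γ • mix (1 - W) (dev x)) (γ • mix (1 - W) e)
  rw [stackNorm_smul, abs_of_nonneg hγ0] at h5
  rw [stackNorm_smul, abs_of_nonneg hη] at h4
  have : laplacianNorm W = specNorm (1 - W) := rfl
  rw [this]
  linarith

/-- Since x already lies in K it equals its projection, so nonexpansiveness bounds the displacement
by the unprojected step. -/
lemma IsNetwork.stackNorm_step_sub_le (hW : IsNetwork G W) (hK : IsClosed K) (hc : Convex ℝ K)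
    (hγ0 : 0 ≤ γ) (hη : 0 ≤ η) (hx : ∀ i, x i ∈ K)
    (hx' : ∀ i, x' i = proj K (x i - γ • mix (1 - W) (x - e) i - η • g i)) :
    stackNorm (x' - x) ≤ γ * laplacianNorm W * (stackNorm (dev x) + stackNorm e)
      + η * stackNorm g := by
  have h : stackNorm (x' - x) ≤ stackNorm (γ • mix (1 - W) (x - e) + η • g) := by
    apply stackNorm_mono
    gcongr with i
    have := norm_proj_sub_proj_le hK hc ⟨_, hx i⟩ (x i - γ • mix (1 - W) (x - e) i - η • g i) (x i)
    rw [proj_eq_self hK (hx i), ← hx'] at this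
    refine this.trans_eq ?_
    rw [← norm_neg]
    congr 1
    simp only [Pi.add_apply, Pi.smul_apply]
    abel
  refine h.trans ((stackNorm_add_le _ _).trans ?_)
  rw [stackNorm_smul, stackNorm_smul, abs_of_nonneg hγ0, abs_of_nonneg hη, mul_assoc]
  have := mul_le_mul_of_nonneg_left (hW.stackNorm_mix_sub_le x e) hγ0
  linarith

/-- The basic descent inequality. -/
lemma IsNetwork.stackNorm_step_sub_const_sq_le (hW : IsNetwork G W) (hK : IsClosed K)
    (hc : Convex ℝ K) (hγ0 : 0 ≤ γ) (hγ1 : γ ≤ 1) {y : Vec d} (hy : y ∈ K)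
    (hx' : ∀ i, x' i = proj K (x i - γ • mix (1 - W) (x - e) i - η • g i)) :
    stackNorm (fun i => x' i - y) ^ 2 ≤ stackNorm (fun i => x i - y) ^ 2
      - 2 * η * ∑ i, inner ℝ (x i - y) (g i)
      + (5 + 2 * laplacianNorm W + 4 * laplacianNorm W ^ 2)
        * (stackNorm (dev x) ^ 2 + laplacianNorm W ^ 2 * stackNorm e ^ 2)
      + 2 * (η * stackNorm g) ^ 2 := by
  set b := mix (1 - W) (x - e) with hb
  set β := laplacianNorm W
  have hβ : 0 ≤ β := specNorm_nonneg _
  have h1 : stackNorm (fun i => x' i - y) ^ 2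
      ≤ ∑ i, ‖(x i - y) - (γ • b i + η • g i)‖ ^ 2 := by
    rw [stackNorm_sq]
    gcongr with i
    have := norm_proj_sub_proj_le hK hc ⟨_, hy⟩ (x i - γ • b i - η • g i) y
    rw [proj_eq_self hK hy, ← hx'] at this
    refine this.trans_eq ?_
    congr 1
    abel
  have h2 : ∑ i, ‖(x i - y) - (γ • b i + η • g i)‖ ^ 2
      = stackNorm (fun i => x i - y) ^ 2 - 2 * γ * ∑ i, inner ℝ (x i - y) (b i)
        - 2 * η * ∑ i, inner ℝ (x i - y) (g i) + stackNorm (γ • b + η • g) ^ 2 := by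
    rw [stackNorm_sq, stackNorm_sq, Finset.mul_sum, Finset.mul_sum, ← Finset.sum_sub_distrib,
      ← Finset.sum_sub_distrib, ← Finset.sum_add_distrib]
    refine Finset.sum_congr rfl fun i _ => ?_
    rw [norm_sub_sq_real, inner_add_right, inner_smul_right, inner_smul_right]
    simp only [Pi.add_apply, Pi.smul_apply]
    ring
  have hbn := hW.stackNorm_mix_sub_le x e
  rw [← hb] at hbn
  have hb0 := stackNorm_nonneg b
  have ha0 := stackNorm_nonneg (dev x)
  have he0 := stackNorm_nonneg e
  -- The comparator drops out because b sums to zero.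
  have h3 : |∑ i, inner ℝ (x i - y) (b i)| ≤ stackNorm (dev x) * stackNorm b := by
    rw [sum_inner_dev x b y (hW.sum_mix_one_sub _)]
    exact sum_inner_le _ _
  have h4 : stackNorm (γ • b + η • g) ^ 2 ≤ 2 * stackNorm b ^ 2 + 2 * (η * stackNorm g) ^ 2 := by
    have h5 := stackNorm_add_le (γ • b) (η • g)
    rw [stackNorm_smul, stackNorm_smul, abs_of_nonneg hγ0] at h5
    have h6 : γ * stackNorm b ≤ stackNorm b := mul_le_of_le_one_left hb0 hγ1
    have h7 : stackNorm (γ • b + η • g) ^ 2 ≤ (stackNorm b + |η| * stackNorm g) ^ 2 :=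
      pow_le_pow_left₀ (stackNorm_nonneg _) (by linarith) 2
    have h8 : (|η| * stackNorm g) ^ 2 = (η * stackNorm g) ^ 2 := by
      rw [mul_pow, mul_pow, sq_abs]
    nlinarith [sq_nonneg (stackNorm b - |η| * stackNorm g)]
  set a := stackNorm (dev x)
  set E := stackNorm e
  have h5 : -(2 * γ * ∑ i, inner ℝ (x i - y) (b i)) ≤ 2 * (a * stackNorm b) := by
    have h6 := (abs_le.1 h3).1
    have h7 : γ * (a * stackNorm b) ≤ a * stackNorm b :=
      mul_le_of_le_one_left (mul_nonneg ha0 hb0) hγ1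
    nlinarith
  have h6 : a * stackNorm b ≤ a * (β * (a + E)) := mul_le_mul_of_nonneg_left hbn ha0
  have h7 : stackNorm b ^ 2 ≤ (β * (a + E)) ^ 2 := pow_le_pow_left₀ hb0 hbn 2
  -- Young's inequality for aβE and for (a + E)² gives a² the coefficient 1 + 2β + 4β² and β²E² the
  -- coefficient 5; the stated factor covers both.
  have h8 : 2 * (a * (β * (a + E))) + 2 * (β * (a + E)) ^ 2
      ≤ (5 + 2 * β + 4 * β ^ 2) * (a ^ 2 + β ^ 2 * E ^ 2) := by
    have i1 : 0 ≤ (a - β * E) ^ 2 := sq_nonneg _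
    have i2 : 0 ≤ β ^ 2 * (a - E) ^ 2 := by positivity
    have i3 : 0 ≤ β * (β ^ 2 * E ^ 2) := by positivity
    have i4 : 0 ≤ β ^ 2 * (β ^ 2 * E ^ 2) := by positivity
    have i5 : 0 ≤ a ^ 2 := sq_nonneg _
    nlinarith
  linarith

end Step

/-! ### Mean square estimates -/

section MeanSquare

variable {S : Type*} [MeasurableSpace S] {Pr : Measure S}

/-- The root mean square of a real random variable. -/
noncomputable def rms (Pr : Measure S) (f : S → ℝ) : ℝ := Real.sqrt (∫ s, f s ^ 2 ∂Pr)

lemma rms_nonneg (f : S → ℝ) : 0 ≤ rms Pr f := Real.sqrt_nonneg _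

lemma rms_sq (f : S → ℝ) : rms Pr f ^ 2 = ∫ s, f s ^ 2 ∂Pr :=
  Real.sq_sqrt (integral_nonneg fun _ => sq_nonneg _)

lemma rms_eq_eLpNorm {f : S → ℝ} (hf : MemLp f 2 Pr) : rms Pr f = (eLpNorm f 2 Pr).toReal := by
  rw [hf.eLpNorm_eq_integral_rpow_norm (by norm_num) (by norm_num), ENNReal.toReal_ofReal
    (by positivity), rms, Real.sqrt_eq_rpow]
  simp

lemma rms_add_le {f g : S → ℝ} (hf : MemLp f 2 Pr) (hg : MemLp g 2 Pr) :
    rms Pr (f + g) ≤ rms Pr f + rms Pr g := by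
  rw [rms_eq_eLpNorm hf, rms_eq_eLpNorm hg, rms_eq_eLpNorm (hf.add hg),
    ← ENNReal.toReal_add hf.eLpNorm_ne_top hg.eLpNorm_ne_top]
  exact ENNReal.toReal_mono (ENNReal.add_ne_top.2 ⟨hf.eLpNorm_ne_top, hg.eLpNorm_ne_top⟩)
    (eLpNorm_add_le hf.1 hg.1 (by norm_num))

lemma rms_const_mul {a : ℝ} (ha : 0 ≤ a) (f : S → ℝ) :
    rms Pr (fun s => a * f s) = a * rms Pr f := by
  simp_rw [rms, mul_pow]
  rw [integral_const_mul, Real.sqrt_mul (by positivity), Real.sqrt_sq ha]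

lemma rms_mono {f g : S → ℝ} (hg : MemLp g 2 Pr) (h0 : ∀ᵐ s ∂Pr, 0 ≤ f s)
    (h : ∀ᵐ s ∂Pr, f s ≤ g s) : rms Pr f ≤ rms Pr g := by
  refine Real.sqrt_le_sqrt (integral_mono_of_nonneg
    (Filter.Eventually.of_forall fun _ => sq_nonneg _)
    hg.integrable_sq ?_)
  filter_upwards [h0, h] with s h1 h2
  exact pow_le_pow_left₀ h1 h2 2

variable [IsProbabilityMeasure Pr]

lemma rms_const {a : ℝ} (ha : 0 ≤ a) : rms Pr (fun _ => a) = a := by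
  simp [rms, Real.sqrt_sq ha]

/-- Minkowski's inequality: a pathwise linear recursion passes to root mean squares with unchanged
coefficients. -/
lemma rms_le_of_le {f g h : S → ℝ} {a b G : ℝ} (ha : 0 ≤ a) (hb : 0 ≤ b) (hG : 0 ≤ G)
    (hg : MemLp g 2 Pr) (hh : MemLp h 2 Pr) (h0 : ∀ᵐ s ∂Pr, 0 ≤ f s)
    (hle : ∀ᵐ s ∂Pr, f s ≤ a * g s + b * h s + G) :
    rms Pr f ≤ a * rms Pr g + b * rms Pr h + G := by
  have h1 : MemLp (fun s => a * g s) 2 Pr := hg.const_mul a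
  have h2 : MemLp (fun s => b * h s) 2 Pr := hh.const_mul b
  have h3 : MemLp (fun _ : S => G) 2 Pr := memLp_const G
  have h4 := rms_mono ((h1.add h2).add h3) h0 hle
  have h5 := rms_add_le (h1.add h2) h3
  have h6 := rms_add_le h1 h2
  rw [rms_const hG] at h5
  rw [rms_const_mul ha, rms_const_mul hb] at h6
  linarith

end MeanSquare

/-! ### Independence -/

section Independence

variable {S A B : Type*} [MeasurableSpace S] [MeasurableSpace A] [MeasurableSpace B]
  {Pr : Measure S} [IsProbabilityMeasure Pr] {X : S → A} {Y : S → B}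

lemma lintegral_comp_of_indepFun (hX : Measurable X) (hY : Measurable Y) (h : IndepFun X Y Pr)
    {f : A × B → ENNReal} (hf : Measurable f) :
    ∫⁻ s, f (X s, Y s) ∂Pr = ∫⁻ s, ∫⁻ y, f (X s, y) ∂(Pr.map Y) ∂Pr := by
  rw [← lintegral_map (f := f) hf (hX.prodMk hY),
    h.map_prod_eq_prod_map_map hX.aemeasurable hY.aemeasurable,
    lintegral_prod _ hf.aemeasurable, lintegral_map (hf.lintegral_prod_right') hX]

lemma integral_comp_of_indepFun (hX : Measurable X) (hY : Measurable Y) (h : IndepFun X Y Pr)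
    {f : A × B → ℝ} (hf : Measurable f) (hi : Integrable (fun s => f (X s, Y s)) Pr) :
    Integrable (fun s => ∫ y, f (X s, y) ∂(Pr.map Y)) Pr ∧
    ∫ s, f (X s, Y s) ∂Pr = ∫ s, ∫ y, f (X s, y) ∂(Pr.map Y) ∂Pr := by
  have hmap := h.map_prod_eq_prod_map_map hX.aemeasurable hY.aemeasurable
  have : IsProbabilityMeasure (Pr.map Y) := Measure.isProbabilityMeasure_map hY.aemeasurable
  have h1 : Integrable f ((Pr.map X).prod (Pr.map Y)) := by
    rw [← hmap, integrable_map_measure hf.aestronglyMeasurable (hX.prodMk hY).aemeasurable]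
    exact hi
  have hm : StronglyMeasurable fun x => ∫ y, f (x, y) ∂(Pr.map Y) :=
    hf.stronglyMeasurable.integral_prod_right'
  constructor
  · exact (integrable_map_measure hm.aestronglyMeasurable hX.aemeasurable).1 h1.integral_prod_left
  · rw [← integral_map (f := f) (hX.prodMk hY).aemeasurable hf.aestronglyMeasurable,
      hmap, integral_prod _ h1, integral_map hX.aemeasurable hm.aestronglyMeasurable]

end Independence

/-! ### Compression -/

section Compression

variable {d : ℕ} {Z S : Type*} [MeasurableSpace Z] [MeasurableSpace S] {C : Vec d → Z → Vec d}
  {ν : Measure Z} [IsProbabilityMeasure ν] {r ω ψ : ℝ}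

/-- As ψr ≤ 1, the residual is a combination of x and the error of C/r with coefficients 1 - ψr and
ψr in size. Convexity of the square gives (1 - ψr) + ψr(1 - ω) = 1 - ψrω. -/
lemma IsCompressor.lintegral_residual_le (hC : IsCompressor C ν r ω) (hr : 1 ≤ r) (hω : ω ≤ 1)
    (hψ0 : 0 < ψ) (hψ : ψ ≤ r⁻¹) (x : Vec d) :
    ∫⁻ z, ‖x - ψ • C x z‖ₑ ^ 2 ∂ν ≤ ENNReal.ofReal (1 - ψ * r * ω) * ‖x‖ₑ ^ 2 := by
  have hr0 : 0 < r := by linarith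
  have ht0 : 0 < ψ * r := by positivity
  have ht1 : ψ * r ≤ 1 := by
    have := mul_le_mul_of_nonneg_right hψ hr0.le
    rwa [inv_mul_cancel₀ hr0.ne'] at this
  have hpt : ∀ z, ‖x - ψ • C x z‖ₑ ^ 2 ≤ ENNReal.ofReal ((1 - ψ * r) * ‖x‖ ^ 2)
      + ENNReal.ofReal (ψ * r) * ‖(1 / r) • C x z - x‖ₑ ^ 2 := fun z => by
    have e : x - ψ • C x z = (1 - ψ * r) • x - (ψ * r) • ((1 / r) • C x z - x) := by
      rw [smul_sub, smul_smul, sub_smul, one_smul]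
      have : ψ * r * (1 / r) = ψ := by field_simp
      rw [this]; abel
    have h1 : ‖x - ψ • C x z‖ ≤ (1 - ψ * r) * ‖x‖ + ψ * r * ‖(1 / r) • C x z - x‖ := by
      rw [e]
      refine (norm_sub_le _ _).trans ?_
      rw [norm_smul, norm_smul, Real.norm_eq_abs, Real.norm_eq_abs, abs_of_nonneg (by linarith),
        abs_of_pos ht0]
    have h2 : ‖x - ψ • C x z‖ ^ 2
        ≤ (1 - ψ * r) * ‖x‖ ^ 2 + ψ * r * ‖(1 / r) • C x z - x‖ ^ 2 := by
      refine (pow_le_pow_left₀ (norm_nonneg _) h1 2).trans ?_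
      have : 0 ≤ (1 - ψ * r) * (ψ * r) * (‖x‖ - ‖(1 / r) • C x z - x‖) ^ 2 := by
        have : 0 ≤ 1 - ψ * r := by linarith
        positivity
      nlinarith
    rw [← ofReal_norm, ← ofReal_norm, ← ENNReal.ofReal_pow (norm_nonneg _),
      ← ENNReal.ofReal_pow (norm_nonneg _), ← ENNReal.ofReal_mul ht0.le,
      ← ENNReal.ofReal_add (mul_nonneg (by linarith) (sq_nonneg _)) (by positivity)]
    exact ENNReal.ofReal_le_ofReal h2
  refine (lintegral_mono hpt).trans ?_
  rw [lintegral_add_left measurable_const, lintegral_const, measure_univ, mul_one,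
    lintegral_const_mul' _ _ ENNReal.ofReal_ne_top]
  refine (add_le_add_right (mul_le_mul_right (hC.error x) _) _).trans_eq ?_
  have hω' : 0 ≤ 1 - ω := by linarith
  have hψω : 0 ≤ 1 - ψ * r * ω := by nlinarith
  rw [← ENNReal.ofReal_mul ht0.le, ← ENNReal.ofReal_add (mul_nonneg (by linarith) (sq_nonneg _))
    (by positivity), ← ofReal_norm, ← ENNReal.ofReal_pow (norm_nonneg _),
    ← ENNReal.ofReal_mul hψω]
  congr 1
  ring

variable {Pr : Measure S} [IsProbabilityMeasure Pr] {e : S → Vec d} {ζ : S → Z}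

/-- The compression residual contracts in mean square. -/
lemma IsCompressor.residual (hC : IsCompressor C ν r ω) (hr : 1 ≤ r) (hω : ω ≤ 1)
    (hψ0 : 0 < ψ) (hψ : ψ ≤ r⁻¹) (he : Measurable e) (hζ : Measurable ζ) (hind : IndepFun e ζ Pr)
    (hlaw : Pr.map ζ = ν) (hL : MemLp e 2 Pr) :
    MemLp (fun s => e s - ψ • C (e s) (ζ s)) 2 Pr ∧
    ∫ s, ‖e s - ψ • C (e s) (ζ s)‖ ^ 2 ∂Pr ≤ (1 - ψ * r * ω) * ∫ s, ‖e s‖ ^ 2 ∂Pr := by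
  have hCm : Measurable fun p : Vec d × Z => p.1 - ψ • C p.1 p.2 :=
    measurable_fst.sub (hC.measurable.const_smul ψ)
  have hfm : Measurable fun p : Vec d × Z => ‖p.1 - ψ • C p.1 p.2‖ₑ ^ 2 := hCm.enorm.pow_const 2
  have hm : Measurable fun s => e s - ψ • C (e s) (ζ s) := hCm.comp (he.prodMk hζ)
  have h1 : ∫⁻ s, ‖e s - ψ • C (e s) (ζ s)‖ₑ ^ 2 ∂Pr
      ≤ ENNReal.ofReal (1 - ψ * r * ω) * ∫⁻ s, ‖e s‖ₑ ^ 2 ∂Pr := by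
    have h2 := lintegral_comp_of_indepFun he hζ hind hfm
    simp only at h2
    rw [h2, hlaw, ← lintegral_const_mul _ (he.enorm.pow_const 2)]
    exact lintegral_mono fun s => hC.lintegral_residual_le hr hω hψ0 hψ (e s)
  have hfin : ∫⁻ s, ‖e s‖ₑ ^ 2 ∂Pr < ⊤ := by
    have := hL.integrable_norm_pow (by norm_num : (2 : ℕ) ≠ 0)
    have h3 := this.2
    simpa [HasFiniteIntegral, enorm_pow] using h3
  have hfin' : ∫⁻ s, ‖e s - ψ • C (e s) (ζ s)‖ₑ ^ 2 ∂Pr < ⊤ :=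
    h1.trans_lt (ENNReal.mul_lt_top ENNReal.ofReal_lt_top hfin)
  have hr0 : 0 < r := by linarith
  have hψω : 0 ≤ 1 - ψ * r * ω := by
    have := mul_le_mul_of_nonneg_right hψ hr0.le
    rw [inv_mul_cancel₀ hr0.ne'] at this
    nlinarith [mul_pos hψ0 hr0]
  have hconv : ∀ {f : S → Vec d}, Measurable f →
      ∫ s, ‖f s‖ ^ 2 ∂Pr = (∫⁻ s, ‖f s‖ₑ ^ 2 ∂Pr).toReal := fun {f} hf => by
    rw [integral_eq_lintegral_of_nonneg_ae (Filter.Eventually.of_forall fun _ => sq_nonneg _)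
      (hf.norm.pow_const 2).aestronglyMeasurable]
    congr 1
    refine lintegral_congr fun s => ?_
    rw [ENNReal.ofReal_pow (norm_nonneg _), ofReal_norm]
  constructor
  · refine (memLp_two_iff_integrable_sq_norm hm.aestronglyMeasurable).2
      ⟨(hm.norm.pow_const 2).aestronglyMeasurable, ?_⟩
    simpa [HasFiniteIntegral, enorm_pow] using hfin'
  · rw [hconv hm, hconv he]
    have := ENNReal.toReal_mono (ENNReal.mul_lt_top ENNReal.ofReal_lt_top hfin).ne h1
    rwa [ENNReal.toReal_mul, ENNReal.toReal_ofReal hψω] at this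

end Compression

/-! ### Trajectories -/

/-- The σ-algebra on S is arbitrary and only inputs before k are required, so the lemma also shows
that x, x̂ and b at time k are functions of the past. Only q uses the compressor noise of time k. -/
lemma measurable_run {n d : ℕ} {Ξ Z S : Type*} [MeasurableSpace Ξ] [MeasurableSpace Z]
    [MeasurableSpace S] {p : Params} {W : Matrix (Fin n) (Fin n) ℝ} {X : Set (Vec d)}
    {F : Fin n → Vec d → Ξ → ℝ} {C : Vec d → Z → Vec d} {x₀ : Fin n → Vec d}
    {u : ℕ → Fin n → S → Vec d} {ξ : ℕ → Fin n → S → Ξ} {ζ : ℕ → Fin n → S → Z}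
    (hF : ∀ i, Measurable (Function.uncurry (F i))) (hC : Measurable (Function.uncurry C))
    (hproj : Measurable (proj (shrink X p.ε))) (k : ℕ)
    (hu : ∀ j < k, ∀ i, Measurable (u j i)) (hξ : ∀ j < k, ∀ i, Measurable (ξ j i))
    (hζ : ∀ j < k, ∀ i, Measurable (ζ j i)) :
    let st := fun s => run p W X F C x₀ (fun k i => u k i s) (fun k i => ξ k i s)
      (fun k i => ζ k i s) k
    (∀ i, Measurable fun s => (st s).x i) ∧ (∀ i, Measurable fun s => (st s).xhat i) ∧
    (∀ i, Measurable fun s => (st s).b i) ∧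
    ((∀ i, Measurable (ζ k i)) → ∀ i, Measurable fun s => (st s).q i) := by
  induction k with
  | zero =>
    exact ⟨fun i => measurable_const, fun i => measurable_const, fun i => measurable_const,
      fun hζ i => hC.comp (measurable_const.prodMk (hζ i))⟩
  | succ k ih =>
    intro st
    obtain ⟨hx, hxh, hb, hq⟩ := ih (fun j hj => hu j (by omega)) (fun j hj => hξ j (by omega))
      (fun j hj => hζ j (by omega))
    have hq := hq (hζ k (by omega))
    have hxh' : ∀ i, Measurable fun s => (st s).xhat i := fun i =>
      (hxh i).add ((hq i).const_smul p.ψ)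
    have hb' : ∀ i, Measurable fun s => (st s).b i := fun i =>
      (hb i).add (((hq i).sub (Finset.measurable_sum _ fun j _ =>
        (hq j).const_smul (W i j))).const_smul p.ψ)
    have hx' : ∀ i, Measurable fun s => (st s).x i := fun i =>
      hproj.comp (((hx i).sub ((hb' i).const_smul p.γ)).sub
        ((Measurable.gradEst (hF i) p.μ (hx i) (hu k (by omega) i) (hξ k (by omega) i)).const_smul
          (p.η k)))
    exact ⟨hx', hxh', hb', fun hζ i => hC.comp (((hx' i).sub (hxh' i)).prodMk (hζ i))⟩

/-- The data of an instance of the stochastic problem together with a realisation of the algorithm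
on a probability space. -/
structure System (n d : ℕ) (Ξ Z S : Type*) [MeasurableSpace Ξ] [MeasurableSpace Z]
    [MeasurableSpace S] where
  p : Params
  W : Matrix (Fin n) (Fin n) ℝ
  X : Set (Vec d)
  F : Fin n → Vec d → Ξ → ℝ
  C : Vec d → Z → Vec d
  x₀ : Fin n → Vec d
  u : ℕ → Fin n → S → Vec d
  ξ : ℕ → Fin n → S → Ξ
  ζ : ℕ → Fin n → S → Z
  P : Fin n → Measure Ξ
  ν : Measure Z
  Pr : Measure S

namespace System

variable {n d : ℕ} {Ξ Z S : Type*} [MeasurableSpace Ξ] [MeasurableSpace Z] [mS : MeasurableSpace S]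

/-- The state of the algorithm. -/
noncomputable def state (M : System n d Ξ Z S) (k : ℕ) (s : S) : State n d :=
  run M.p M.W M.X M.F M.C M.x₀ (fun k i => M.u k i s) (fun k i => M.ξ k i s)
    (fun k i => M.ζ k i s) k

/-- The iterates. -/
noncomputable def x (M : System n d Ξ Z S) (k : ℕ) (s : S) : Fin n → Vec d := (M.state k s).x

/-- The tracking errors `x - x̂`. -/
noncomputable def err (M : System n d Ξ Z S) (k : ℕ) (s : S) : Fin n → Vec d :=
  fun i => (M.state k s).x i - (M.state k s).xhat i

/-- The residuals `x_k - x̂_{k+1}` of the compression. -/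
noncomputable def res (M : System n d Ξ Z S) (k : ℕ) (s : S) : Fin n → Vec d :=
  fun i => M.err k s i - M.p.ψ • M.C (M.err k s i) (M.ζ k i s)

/-- The gradient estimates. -/
noncomputable def grad (M : System n d Ξ Z S) (k : ℕ) (s : S) : Fin n → Vec d :=
  fun i => gradEst (M.F i) M.p.μ (M.x k s i) (M.u k i s) (M.ξ k i s)

variable (M : System n d Ξ Z S)

lemma q_eq (k : ℕ) (s : S) (i : Fin n) :
    (M.state k s).q i = M.C (M.err k s i) (M.ζ k i s) := by
  cases k with
  | zero =>
    have : M.err 0 s i = M.x₀ i := sub_zero _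
    rw [this]; rfl
  | succ k => rfl

lemma xhat_succ (k : ℕ) (s : S) (i : Fin n) :
    (M.state (k + 1) s).xhat i = M.x k s i - M.res k s i := by
  have : (M.state (k + 1) s).xhat i
      = (M.state k s).xhat i + M.p.ψ • (M.state k s).q i := rfl
  rw [this, q_eq, res, err, x]
  abel

/-- Both sides start at zero, and their increments agree because I - W is linear. -/
lemma b_eq (k : ℕ) (s : S) : (M.state k s).b = mix (1 - M.W) (M.state k s).xhat := by
  induction k with
  | zero =>
    ext1 i
    change (0 : Vec d) = ∑ j, (1 - M.W) i j • (0 : Vec d)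
    simp
  | succ k ih =>
    have h1 : (M.state (k + 1) s).b
        = (M.state k s).b + M.p.ψ • ((M.state k s).q - mix M.W (M.state k s).q) := rfl
    have h2 : (M.state (k + 1) s).xhat = (M.state k s).xhat + M.p.ψ • (M.state k s).q := rfl
    rw [h1, h2, mix_add, mix_smul, ← ih, mix_one_sub]

lemma x_succ (k : ℕ) (s : S) (i : Fin n) :
    M.x (k + 1) s i = proj (shrink M.X M.p.ε)
      (M.x k s i - M.p.γ • mix (1 - M.W) (M.x k s - M.res k s) i - M.p.η k • M.grad k s i) := by
  have h1 : M.x (k + 1) s i = proj (shrink M.X M.p.ε)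
      (M.x k s i - M.p.γ • (M.state (k + 1) s).b i - M.p.η k • M.grad k s i) := rfl
  have h2 : (M.state (k + 1) s).xhat = M.x k s - M.res k s := funext fun i => M.xhat_succ k s i
  rw [h1, b_eq, h2]

lemma err_zero (s : S) : M.err 0 s = M.x₀ := funext fun _ => sub_zero _

/-- The next tracking error is the old residual plus the motion of the iterate, which closes the
recursion between consensus and compression. -/
lemma err_succ (k : ℕ) (s : S) : M.err (k + 1) s = (M.x (k + 1) s - M.x k s) + M.res k s := by
  ext1 i
  have : M.err (k + 1) s i = M.x (k + 1) s i - (M.state (k + 1) s).xhat i := rfl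
  rw [this, xhat_succ]
  simp only [Pi.add_apply, Pi.sub_apply]
  abel

/-- The standing assumptions. -/
structure Valid (M : System n d Ξ Z S) (G : SimpleGraph (Fin n)) (Lf Lm σ Rlo Rhi r ω : ℝ) :
    Prop where
  network : IsNetwork G M.W
  constraint : IsConstraintSet M.X Rlo Rhi
  problem : IsSmoothProblem M.X M.F M.P Lf Lm σ
  compressor : IsCompressor M.C M.ν r ω
  sampling : IsSampling M.Pr M.P M.ν M.u M.ξ M.ζ
  prob : IsProbabilityMeasure M.Pr
  probP : ∀ i, IsProbabilityMeasure (M.P i)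
  probν : IsProbabilityMeasure M.ν
  start : ∀ i, M.x₀ i ∈ M.X
  d_pos : 0 < d
  Lf_pos : 0 < Lf
  Lm_pos : 0 < Lm
  Rlo_pos : 0 < Rlo
  one_le_r : 1 ≤ r
  ω_pos : 0 < ω
  ω_le : ω ≤ 1
  ψ_pos : 0 < M.p.ψ
  ψ_le : M.p.ψ ≤ r⁻¹
  γ_adm : GammaAdmissible (spectralGap M.W) (laplacianNorm M.W) M.p.γ (M.p.ψ * r * ω / 2)
  μ_pos : 0 < M.p.μ
  ε_pos : 0 < M.p.ε
  ε_lt : M.p.ε < 1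
  μ_le : M.p.μ ≤ M.p.ε * Rlo
  η_nonneg : ∀ k, 0 ≤ M.p.η k

section Measurability

variable {M}

variable {G : SimpleGraph (Fin n)} {Lf Lm σ Rlo Rhi r ω : ℝ}

namespace Valid

variable (h : M.Valid G Lf Lm σ Rlo Rhi r ω)
include h

lemma zero_mem : (0 : Vec d) ∈ M.X := h.constraint.zero_mem h.Rlo_pos

lemma isClosed_shrink : IsClosed (shrink M.X M.p.ε) :=
  ComDSZO.isClosed_shrink h.constraint.closed h.ε_lt

lemma convex_shrink : Convex ℝ (shrink M.X M.p.ε) := ComDSZO.convex_shrink h.constraint.convex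

lemma shrink_nonempty : (shrink M.X M.p.ε).Nonempty := ⟨0, zero_mem_shrink h.zero_mem⟩

lemma measurable_proj : Measurable (proj (shrink M.X M.p.ε)) :=
  (continuous_proj h.isClosed_shrink h.convex_shrink h.shrink_nonempty).measurable

lemma measurable_x (k : ℕ) (i : Fin n) : Measurable fun s => M.x k s i :=
  (measurable_run h.problem.measurable h.compressor.measurable h.measurable_proj k
    (fun j _ => h.sampling.measurable_u j) (fun j _ => h.sampling.measurable_ξ j)
    (fun j _ => h.sampling.measurable_ζ j)).1 i

lemma measurable_err (k : ℕ) (i : Fin n) : Measurable fun s => M.err k s i := by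
  have := measurable_run (p := M.p) (W := M.W) (x₀ := M.x₀)
    h.problem.measurable h.compressor.measurable h.measurable_proj k
    (fun j _ => h.sampling.measurable_u j) (fun j _ => h.sampling.measurable_ξ j)
    (fun j _ => h.sampling.measurable_ζ j)
  exact (this.1 i).sub (this.2.1 i)

lemma measurable_res (k : ℕ) (i : Fin n) : Measurable fun s => M.res k s i :=
  (h.measurable_err k i).sub ((h.compressor.measurable.comp
    ((h.measurable_err k i).prodMk (h.sampling.measurable_ζ k i))).const_smul M.p.ψ)

lemma measurable_grad (k : ℕ) (i : Fin n) : Measurable fun s => M.grad k s i :=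
  Measurable.gradEst (h.problem.measurable i) M.p.μ (h.measurable_x k i)
    (h.sampling.measurable_u k i) (h.sampling.measurable_ξ k i)

/-- The state before step `k` is independent of the inputs of step `k`. -/
lemma indepFun_past (k : ℕ) (i : Fin n) :
    IndepFun (fun s => (M.x k s i, M.err k s i))
      (fun s => (M.u k i s, M.ξ k i s, M.ζ k i s)) M.Pr := by
  let Y : ℕ → S → Fin n → Vec d × Ξ × Z := fun k s i => (M.u k i s, M.ξ k i s, M.ζ k i s)
  have hY : ∀ k, Measurable (Y k) := fun k =>
    measurable_pi_lambda _ fun i => (h.sampling.measurable_u k i).prodMk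
      ((h.sampling.measurable_ξ k i).prodMk (h.sampling.measurable_ζ k i))
  let m : ℕ → MeasurableSpace S := fun k => MeasurableSpace.comap (Y k) inferInstance
  have hind : iIndep m M.Pr := h.sampling.indep
  have hle : ∀ k, m k ≤ mS := fun k => (hY k).comap_le
  -- The inputs before k and those at k generate independent σ-algebras; the state before step k is
  -- measurable for the former.
  have hdis : Disjoint (Set.Iio k) {k} := by simp
  have hI := indep_iSup_of_disjoint hle hind hdis
  have hcomp : ∀ j i, Measurable[m j] fun s => (M.u j i s, M.ξ j i s, M.ζ j i s) := fun j i =>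
    (measurable_pi_apply i).comp (comap_measurable (Y j))
  rw [IndepFun_iff_Indep]
  refine indep_of_indep_of_le_left (indep_of_indep_of_le_right hI ?_) ?_
  · have h1 : m k ≤ ⨆ j ∈ ({k} : Set ℕ), m j := le_iSup₂_of_le k rfl le_rfl
    refine le_trans ?_ h1
    rw [← measurable_iff_comap_le]
    exact hcomp k i
  · rw [← measurable_iff_comap_le]
    have hj : ∀ j < k, ∀ i, Measurable[⨆ j ∈ Set.Iio k, m j]
        fun s => (M.u j i s, M.ξ j i s, M.ζ j i s) := fun j hj i => by
      have h1 : m j ≤ ⨆ j ∈ Set.Iio k, m j := le_iSup₂_of_le j hj le_rfl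
      exact (hcomp j i).mono h1 le_rfl
    have h3 := @measurable_run n d Ξ Z S _ _ (⨆ j ∈ Set.Iio k, m j) M.p M.W M.X M.F M.C M.x₀
      M.u M.ξ M.ζ h.problem.measurable h.compressor.measurable h.measurable_proj k
      (fun j hjk i => measurable_fst.comp (hj j hjk i))
      (fun j hjk i => (measurable_fst.comp measurable_snd).comp (hj j hjk i))
      (fun j hjk i => (measurable_snd.comp measurable_snd).comp (hj j hjk i))
    exact (h3.1 i).prodMk ((h3.1 i).sub (h3.2.1 i))

lemma map_ζ (k : ℕ) (i : Fin n) : M.Pr.map (M.ζ k i) = M.ν := by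
  have := h.probP
  have := h.probν
  have := isProbabilityMeasure_sphereUniform h.d_pos
  have hm := (h.sampling.measurable_u k i).prodMk
      ((h.sampling.measurable_ξ k i).prodMk (h.sampling.measurable_ζ k i))
  have h1 : M.Pr.map (M.ζ k i)
      = ((M.Pr.map fun s => (M.u k i s, M.ξ k i s, M.ζ k i s)).map Prod.snd).map Prod.snd := by
    rw [Measure.map_map measurable_snd hm, Measure.map_map measurable_snd (measurable_snd.comp hm)]
    rfl
  rw [h1, h.sampling.law, Measure.map_snd_prod, measure_univ, one_smul, Measure.map_snd_prod,
    measure_univ, one_smul]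

lemma map_u_ξ (k : ℕ) (i : Fin n) :
    M.Pr.map (fun s => (M.u k i s, M.ξ k i s)) = (sphereUniform d).prod (M.P i) := by
  have := h.probP
  have := h.probν
  have := isProbabilityMeasure_sphereUniform h.d_pos
  have hm := (h.sampling.measurable_u k i).prodMk
      ((h.sampling.measurable_ξ k i).prodMk (h.sampling.measurable_ζ k i))
  have h1 : M.Pr.map (fun s => (M.u k i s, M.ξ k i s))
      = (M.Pr.map fun s => (M.u k i s, M.ξ k i s, M.ζ k i s)).map (Prod.map id Prod.fst) := by
    rw [Measure.map_map (measurable_id.prodMap measurable_fst) hm]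
    rfl
  rw [h1, h.sampling.law, ← Measure.map_prod_map _ _ measurable_id measurable_fst, Measure.map_id,
    Measure.map_fst_prod, measure_univ, one_smul]

end Valid

end Measurability

end System

/-! ### Measurability and second moments of stacked random vectors -/

section StackMeasurability

variable {n d : ℕ} {S : Type*} [MeasurableSpace S] {Pr : Measure S} {f : S → Fin n → Vec d}

lemma measurable_stackNorm (hf : ∀ i, Measurable fun s => f s i) :
    Measurable fun s => stackNorm (f s) := by
  have h : (fun s => stackNorm (f s)) = fun s => Real.sqrt (∑ i, ‖f s i‖ ^ 2) := by
    ext s; rw [← stackNorm_sq, Real.sqrt_sq (stackNorm_nonneg _)]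
  rw [h]
  exact (Finset.measurable_sum _ fun i _ => (hf i).norm.pow_const 2).sqrt

lemma measurable_mean (hf : ∀ i, Measurable fun s => f s i) : Measurable fun s => mean (f s) :=
  (Finset.measurable_sum _ fun i _ => hf i).const_smul (1 / (n : ℝ))

lemma measurable_dev (hf : ∀ i, Measurable fun s => f s i) (i : Fin n) :
    Measurable fun s => dev (f s) i :=
  (hf i).sub (measurable_mean hf)

lemma memLp_stackNorm (hf : ∀ i, Measurable fun s => f s i)
    (hL : ∀ i, MemLp (fun s => f s i) 2 Pr) : MemLp (fun s => stackNorm (f s)) 2 Pr := by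
  rw [memLp_two_iff_integrable_sq (measurable_stackNorm hf).aestronglyMeasurable]
  simp_rw [stackNorm_sq]
  exact integrable_finsetSum _ fun i _ => (hL i).integrable_norm_pow two_ne_zero

lemma rms_stackNorm_sq (hL : ∀ i, MemLp (fun s => f s i) 2 Pr) :
    rms Pr (fun s => stackNorm (f s)) ^ 2 = ∑ i, ∫ s, ‖f s i‖ ^ 2 ∂Pr := by
  rw [rms_sq]
  simp_rw [stackNorm_sq]
  exact integral_finsetSum _ fun i _ => (hL i).integrable_norm_pow two_ne_zero

end StackMeasurability

/-! ### Mean square recursions along the algorithm -/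

namespace System

variable {n d : ℕ} {Ξ Z S : Type*} [MeasurableSpace Ξ] [MeasurableSpace Z] [MeasurableSpace S]
  (M : System n d Ξ Z S)

/-- The root mean square disagreement of the agents. -/
noncomputable def devRms (k : ℕ) : ℝ := rms M.Pr fun s => stackNorm (dev (M.x k s))

/-- The root mean square compression residual. -/
noncomputable def resRms (k : ℕ) : ℝ := rms M.Pr fun s => stackNorm (M.res k s)

/-- The expected squared distance of the agents to a point. -/
noncomputable def sqDist (y : Vec d) (k : ℕ) : ℝ :=
  ∫ s, stackNorm (fun i => M.x k s i - y) ^ 2 ∂M.Pr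

namespace Valid

variable {M} {G : SimpleGraph (Fin n)} {Lf Lm σ Rlo Rhi r ω : ℝ}
  (h : M.Valid G Lf Lm σ Rlo Rhi r ω)
include h

lemma x_mem_shrink {k : ℕ} (hk : 1 ≤ k) (s : S) (i : Fin n) :
    M.x k s i ∈ shrink M.X M.p.ε := by
  obtain ⟨k, rfl⟩ := Nat.exists_eq_add_of_le' hk
  rw [M.x_succ]
  exact proj_mem h.isClosed_shrink h.shrink_nonempty _

lemma shrink_subset : shrink M.X M.p.ε ⊆ M.X :=
  ComDSZO.shrink_subset h.constraint.convex h.zero_mem h.ε_pos.le h.ε_lt.le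

lemma x_mem (k : ℕ) (s : S) (i : Fin n) : M.x k s i ∈ M.X := by
  cases k with
  | zero => exact h.start i
  | succ k => exact h.shrink_subset (h.x_mem_shrink (by omega) s i)

lemma norm_x_le (k : ℕ) (s : S) (i : Fin n) : ‖M.x k s i‖ ≤ Rhi :=
  h.constraint.norm_le (h.x_mem k s i)

lemma Rhi_nonneg : 0 ≤ Rhi := by simpa using h.constraint.norm_le h.zero_mem

lemma mean_x_mem (k : ℕ) (s : S) : mean (M.x k s) ∈ M.X := by
  have hn : (n : ℝ) ≠ 0 := by exact_mod_cast h.network.ne_zero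
  rw [mean, Finset.smul_sum]
  exact h.constraint.convex.sum_mem (fun _ _ => by positivity) (by simp [hn])
    fun i _ => h.x_mem k s i

lemma stackNorm_x_le (k : ℕ) (s : S) : stackNorm (M.x k s) ≤ Real.sqrt n * Rhi :=
  stackNorm_le_of_forall h.Rhi_nonneg (h.norm_x_le k s)

lemma stackNorm_dev_x_le (k : ℕ) (s : S) : stackNorm (dev (M.x k s)) ≤ Real.sqrt n * Rhi :=
  (stackNorm_dev_le h.network.ne_zero _).trans (h.stackNorm_x_le k s)

lemma memLp_x (k : ℕ) (i : Fin n) : MemLp (fun s => M.x k s i) 2 M.Pr :=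
  have := h.prob
  MemLp.of_bound (h.measurable_x k i).aestronglyMeasurable Rhi
    (Filter.Eventually.of_forall fun s => h.norm_x_le k s i)

lemma memLp_stackNorm_dev (k : ℕ) : MemLp (fun s => stackNorm (dev (M.x k s))) 2 M.Pr := by
  have := h.prob
  refine MemLp.of_bound
    (measurable_stackNorm (measurable_dev (h.measurable_x k))).aestronglyMeasurable
    (Real.sqrt n * Rhi) (Filter.Eventually.of_forall fun s => ?_)
  rw [Real.norm_eq_abs, abs_of_nonneg (stackNorm_nonneg _)]
  exact h.stackNorm_dev_x_le k s

lemma ψrω_pos : 0 < M.p.ψ * r * ω :=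
  mul_pos (mul_pos h.ψ_pos (by linarith [h.one_le_r])) h.ω_pos

lemma ψrω_le_one : M.p.ψ * r * ω ≤ 1 := by
  have hr : 0 < r := by linarith [h.one_le_r]
  have := mul_le_mul_of_nonneg_right h.ψ_le hr.le
  rw [inv_mul_cancel₀ hr.ne'] at this
  exact mul_le_one₀ this h.ω_pos.le h.ω_le

lemma indepFun_err (k : ℕ) (i : Fin n) :
    IndepFun (fun s => M.err k s i) (M.ζ k i) M.Pr :=
  (h.indepFun_past k i).comp measurable_snd (measurable_snd.comp measurable_snd)

lemma res_of_err {k : ℕ} {i : Fin n} (hL : MemLp (fun s => M.err k s i) 2 M.Pr) :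
    MemLp (fun s => M.res k s i) 2 M.Pr ∧
    ∫ s, ‖M.res k s i‖ ^ 2 ∂M.Pr ≤ (1 - M.p.ψ * r * ω) * ∫ s, ‖M.err k s i‖ ^ 2 ∂M.Pr :=
  have := h.prob
  have := h.probν
  h.compressor.residual h.one_le_r h.ω_le h.ψ_pos h.ψ_le (h.measurable_err k i)
    (h.sampling.measurable_ζ k i) (h.indepFun_err k i) (h.map_ζ k i) hL

lemma memLp_err (k : ℕ) (i : Fin n) : MemLp (fun s => M.err k s i) 2 M.Pr := by
  induction k with
  | zero =>
    simp_rw [err_zero]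
    exact h.memLp_x 0 i
  | succ k ih =>
    simp_rw [err_succ]
    exact ((h.memLp_x (k + 1) i).sub (h.memLp_x k i)).add (h.res_of_err ih).1

lemma memLp_res (k : ℕ) (i : Fin n) : MemLp (fun s => M.res k s i) 2 M.Pr :=
  (h.res_of_err (h.memLp_err k i)).1

lemma memLp_stackNorm_res (k : ℕ) : MemLp (fun s => stackNorm (M.res k s)) 2 M.Pr :=
  memLp_stackNorm (h.measurable_res k) (h.memLp_res k)

/-- Squares contract by 1 - ψrω agent by agent, and 1 - t ≤ (1 - t/2)²; this is where c₀ = ψrω/2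
comes from. -/
lemma resRms_le (k : ℕ) :
    M.resRms k ≤ (1 - M.p.ψ * r * ω / 2) * rms M.Pr fun s => stackNorm (M.err k s) := by
  have h1 := h.ψrω_pos
  have h2 := h.ψrω_le_one
  refine abs_le_of_sq_le_sq' ?_ (mul_nonneg (by linarith) (rms_nonneg _)) |>.2
  rw [resRms, mul_pow, rms_stackNorm_sq (h.memLp_res k), rms_stackNorm_sq (h.memLp_err k),
    Finset.mul_sum]
  gcongr with i
  refine (h.res_of_err (h.memLp_err k i)).2.trans ?_
  gcongr
  nlinarith

/-- The restriction k ≥ 1 matters: the starting point lies in Ω but perhaps not in Ω_ε, so the first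
query may leave Ω, where nothing is known about the loss. -/
lemma ae_norm_grad_le {k : ℕ} (hk : 1 ≤ k) (i : Fin n) :
    ∀ᵐ s ∂M.Pr, ‖M.grad k s i‖ ≤ d * Lf := by
  have := h.probP
  have := isProbabilityMeasure_sphereUniform h.d_pos
  have hm : Measurable fun s => (M.u k i s, M.ξ k i s) :=
    (h.sampling.measurable_u k i).prodMk (h.sampling.measurable_ξ k i)
  have h1 : ∀ᵐ s ∂M.Pr, ‖M.u k i s‖ = 1 := by
    have e : ∀ᵐ p ∂(M.Pr.map fun s => (M.u k i s, M.ξ k i s)), ‖p.1‖ = 1 := by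
      rw [h.map_u_ξ]
      exact Measure.quasiMeasurePreserving_fst.ae ae_norm_eq_one_sphereUniform
    exact ae_of_ae_map hm.aemeasurable e
  have h2 : ∀ᵐ s ∂M.Pr, ∀ x ∈ M.X, ∀ y ∈ M.X,
      |M.F i x (M.ξ k i s) - M.F i y (M.ξ k i s)| ≤ Lf * ‖x - y‖ := by
    have e : ∀ᵐ p ∂(M.Pr.map fun s => (M.u k i s, M.ξ k i s)), ∀ x ∈ M.X, ∀ y ∈ M.X,
        |M.F i x p.2 - M.F i y p.2| ≤ Lf * ‖x - y‖ := by
      rw [h.map_u_ξ]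
      exact (Measure.quasiMeasurePreserving_snd (μ := sphereUniform d)).ae (h.problem.lipschitz i)
    exact ae_of_ae_map hm.aemeasurable e
  filter_upwards [h1, h2] with s hs1 hs2
  refine norm_gradEst_le (f := M.F i) h.μ_pos hs1 (h.x_mem k s i) ?_ hs2
  refine h.constraint.add_mem h.ε_pos h.ε_lt.le (h.x_mem_shrink hk s i) ?_
  rw [norm_smul, hs1, Real.norm_eq_abs, abs_of_pos h.μ_pos, mul_one]
  exact h.μ_le

lemma ae_stackNorm_grad_le {k : ℕ} (hk : 1 ≤ k) :
    ∀ᵐ s ∂M.Pr, stackNorm (M.grad k s) ≤ Real.sqrt n * (d * Lf) := by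
  filter_upwards [ae_all_iff.2 fun i => h.ae_norm_grad_le hk i] with s hs
  exact stackNorm_le_of_forall (mul_nonneg (by positivity) h.Lf_pos.le) hs

lemma step_nonneg (k : ℕ) : 0 ≤ M.p.η k * (Real.sqrt n * (d * Lf)) :=
  mul_nonneg (h.η_nonneg k) (mul_nonneg (Real.sqrt_nonneg _)
    (mul_nonneg (Nat.cast_nonneg _) h.Lf_pos.le))

lemma devRms_succ_le {k : ℕ} (hk : 1 ≤ k) :
    M.devRms (k + 1) ≤ (1 - M.p.γ * spectralGap M.W) * M.devRms k
      + M.p.γ * laplacianNorm M.W * M.resRms k + M.p.η k * (Real.sqrt n * (d * Lf)) := by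
  have := h.prob
  have hγ := h.γ_adm.1
  have hγ1 := h.γ_adm.2.1
  have hδ := h.γ_adm.delta_pos
  have hδ1 := spectralGap_le_one M.W
  refine rms_le_of_le (by nlinarith) (mul_nonneg hγ.le (specNorm_nonneg _)) (h.step_nonneg k)
    (h.memLp_stackNorm_dev k) (h.memLp_stackNorm_res k)
    (Filter.Eventually.of_forall fun _ => stackNorm_nonneg _) ?_
  filter_upwards [h.ae_stackNorm_grad_le hk] with s hs
  have h1 := h.network.stackNorm_dev_step_le h.isClosed_shrink h.convex_shrink h.shrink_nonempty
    hγ.le hγ1.le (h.η_nonneg k) (M.x_succ k s)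
  have h2 := mul_le_mul_of_nonneg_left hs (h.η_nonneg k)
  linarith

lemma resRms_succ_le {k : ℕ} (hk : 1 ≤ k) :
    M.resRms (k + 1) ≤ (1 - M.p.ψ * r * ω / 2) * (M.p.γ * laplacianNorm M.W * M.devRms k
      + (1 + M.p.γ * laplacianNorm M.W) * M.resRms k + M.p.η k * (Real.sqrt n * (d * Lf))) := by
  have := h.prob
  have hγ := h.γ_adm.1
  have hβ : 0 ≤ laplacianNorm M.W := specNorm_nonneg _
  refine (h.resRms_le (k + 1)).trans (mul_le_mul_of_nonneg_left ?_ (by linarith [h.ψrω_le_one]))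
  refine rms_le_of_le (by positivity) (by positivity) (h.step_nonneg k)
    (h.memLp_stackNorm_dev k) (h.memLp_stackNorm_res k)
    (Filter.Eventually.of_forall fun _ => stackNorm_nonneg _) ?_
  filter_upwards [h.ae_stackNorm_grad_le hk] with s hs
  have h1 := h.network.stackNorm_step_sub_le h.isClosed_shrink h.convex_shrink
    hγ.le (h.η_nonneg k) (h.x_mem_shrink hk s) (M.x_succ k s)
  have h2 := mul_le_mul_of_nonneg_left hs (h.η_nonneg k)
  have h3 := stackNorm_add_le (M.x (k + 1) s - M.x k s) (M.res k s)
  rw [err_succ]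
  linarith

lemma devRms_le (k : ℕ) : M.devRms k ≤ Real.sqrt n * Rhi := by
  have := h.prob
  have h0 : 0 ≤ Real.sqrt n * Rhi := mul_nonneg (Real.sqrt_nonneg _) h.Rhi_nonneg
  rw [← rms_const (Pr := M.Pr) h0]
  exact rms_mono (memLp_const _) (Filter.Eventually.of_forall fun _ => stackNorm_nonneg _)
    (Filter.Eventually.of_forall fun s => h.stackNorm_dev_x_le k s)

lemma resRms_le_rms_err (k : ℕ) : M.resRms k ≤ rms M.Pr fun s => stackNorm (M.err k s) :=
  (h.resRms_le k).trans (mul_le_of_le_one_left (rms_nonneg _) (by linarith [h.ψrω_pos]))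

/-- The recursion begins at k = 1, so its initial value must avoid the gradient of step 0.
Boundedness of Ω suffices: one radius for the initial residual and two for the first move. -/
lemma resRms_one_le : M.resRms 1 ≤ 3 * (Real.sqrt n * Rhi) := by
  have := h.prob
  have h0 : 0 ≤ Real.sqrt n * Rhi := mul_nonneg (Real.sqrt_nonneg _) h.Rhi_nonneg
  have h1 : M.resRms 0 ≤ Real.sqrt n * Rhi := by
    refine (h.resRms_le_rms_err 0).trans ?_
    simp_rw [err_zero]
    rw [rms_const (stackNorm_nonneg _)]
    exact stackNorm_le_of_forall h.Rhi_nonneg fun i => h.constraint.norm_le (h.start i)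
  have h2 : rms M.Pr (fun s => stackNorm (M.err 1 s))
      ≤ 1 * M.resRms 0 + 0 * M.resRms 0 + 2 * (Real.sqrt n * Rhi) := by
    refine rms_le_of_le zero_le_one le_rfl (by linarith) (h.memLp_stackNorm_res 0)
      (h.memLp_stackNorm_res 0) (Filter.Eventually.of_forall fun _ => stackNorm_nonneg _)
      (Filter.Eventually.of_forall fun s => ?_)
    rw [err_succ]
    have h3 := stackNorm_add_le (M.x (0 + 1) s - M.x 0 s) (M.res 0 s)
    have h4 := stackNorm_sub_le (M.x (0 + 1) s) (M.x 0 s)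
    have h5 := h.stackNorm_x_le (0 + 1) s
    have h6 := h.stackNorm_x_le 0 s
    linarith
  linarith [h.resRms_le_rms_err 1]

end Valid

end System

/-! ### The weighted consensus and compression energy -/

lemma IsNetwork.laplacianNorm_eq_zero {n : ℕ} {G : SimpleGraph (Fin n)}
    {W : Matrix (Fin n) (Fin n) ℝ} (hW : IsNetwork G W) (hn : n = 1) : laplacianNorm W = 0 := by
  subst hn
  have h : (1 : Matrix (Fin 1) (Fin 1) ℝ) - W = 0 := by
    ext i j
    have h1 := hW.row_sum i
    rw [Fin.sum_univ_one] at h1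
    rw [Subsingleton.elim j 0, Matrix.sub_apply, h1, Subsingleton.elim i 0]
    simp
  rw [laplacianNorm, h, specNorm, map_zero, norm_zero]

lemma dev_eq_zero {n d : ℕ} (hn : n = 1) (x : Fin n → Vec d) : dev x = 0 := by
  subst hn
  ext1 i
  simp [dev, mean, Subsingleton.elim i 0]

/-- The constant in the bound on the weighted consensus and compression energy. -/
noncomputable def energyConst (n : ℕ) (δ β γ B R : ℝ) : ℝ :=
  let l := 1 - γ * δ * (γ * β ^ 2 * (1 + 2 / δ)) / 3
  (1 + β ^ 4 / δ ^ 2) * (((4 * (Real.sqrt n * R)) ^ 2 + (2 * B) ^ 2 / (1 - l) / (1 - l)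
    + 3 * ((2 * B) ^ 2 / (1 - l))) / (1 - l))

lemma energyConst_nonneg {n : ℕ} {δ β γ B R : ℝ} (hγ : 0 ≤ γ) (hδ : 0 ≤ δ) :
    0 ≤ energyConst n δ β γ B R := by
  unfold energyConst
  simp only [sub_sub_cancel]
  positivity

namespace System

variable {n d : ℕ} {Ξ Z S : Type*} [MeasurableSpace Ξ] [MeasurableSpace Z] [MeasurableSpace S]
  {M : System n d Ξ Z S} {G : SimpleGraph (Fin n)} {Lf Lm σ Rlo Rhi r ω : ℝ}

namespace Valid

/-- The weighted consensus and compression energy is of order `√(T + c)`. -/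
lemma sum_energy_le (h : M.Valid G Lf Lm σ Rlo Rhi r ω) {c B : ℝ} (hc : 4 < c)
    (hB : ∀ k, M.p.η k * (Real.sqrt n * (d * Lf)) ≤ B / weight c k) {T : ℕ} (hT : 1 ≤ T) :
    ∑ k ∈ Finset.Icc 1 T, weight c k * (M.devRms k ^ 2 + laplacianNorm M.W ^ 2 * M.resRms k ^ 2)
      ≤ energyConst n (spectralGap M.W) (laplacianNorm M.W) M.p.γ B Rhi * weight c T := by
  have hγ := h.γ_adm.1
  have hγ1 := h.γ_adm.2.1
  have hδ := h.γ_adm.delta_pos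
  have hδ1 := spectralGap_le_one M.W
  have hn0 := h.network.ne_zero
  have hw := fun k => one_le_weight hc k
  rcases (by omega : n = 1 ∨ 2 ≤ n) with hn | hn
  -- For a single agent β = 0 and the norm a + (δ/β) p is meaningless, but the energy vanishes.
  · have h1 : ∀ k, M.devRms k = 0 := fun k => by
      simp [devRms, rms, dev_eq_zero hn, stackNorm_sq]
    simp_rw [h1, h.network.laplacianNorm_eq_zero hn]
    simp only [ne_eq, OfNat.ofNat_ne_zero, not_false_eq_true, zero_pow, zero_mul, add_zero,
      mul_zero, Finset.sum_const_zero]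
    exact mul_nonneg (energyConst_nonneg hγ.le hδ.le) (zero_le_one.trans (hw T))
  · have hδβ : spectralGap M.W ≤ laplacianNorm M.W := spectralGap_le_laplacianNorm hn
    set δ := spectralGap M.W
    set β := laplacianNorm M.W
    have hβ : 0 < β := by linarith
    set l := 1 - M.p.γ * δ * (M.p.γ * β ^ 2 * (1 + 2 / δ)) / 3 with hl
    have hc0 : 0 < M.p.ψ * r * ω / 2 := by linarith [h.ψrω_pos]
    have hl1 : l < 1 := by
      have : 0 < M.p.γ * δ * (M.p.γ * β ^ 2 * (1 + 2 / δ)) / 3 := by positivity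
      linarith
    have hl0 : 0 ≤ l := by
      have h1 := h.γ_adm.2.2.2
      have h2 : 0 ≤ M.p.γ * ((1 + (M.p.ψ * r * ω / 2)⁻¹) ^ 2 * M.p.γ * β ^ 2) := by positivity
      have h3 : M.p.γ * β ^ 2 * (1 + 2 / δ) ≤ 1 := by
        unfold kappa2 at h1
        linarith [h.ψrω_le_one]
      have h4 : M.p.γ * δ * (M.p.γ * β ^ 2 * (1 + 2 / δ)) ≤ 1 :=
        mul_le_one₀ (mul_le_one₀ hγ1.le hδ.le hδ1) (by positivity) h3
      linarith
    have ha0 : ∀ k, 0 ≤ M.devRms k := fun k => rms_nonneg _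
    have hp0 : ∀ k, 0 ≤ M.resRms k := fun k => rms_nonneg _
    have hV := sum_weight_mul_sq_le (V := fun k => M.devRms k + δ / β * M.resRms k)
      (V₁ := 4 * (Real.sqrt n * Rhi)) (B := 2 * B) hc hl0 hl1
      (fun k _ => add_nonneg (ha0 k) (mul_nonneg (by positivity) (hp0 k))) (by
        have h1 := h.devRms_le 1
        have h2 := h.resRms_one_le
        have h3 : δ / β * M.resRms 1 ≤ M.resRms 1 :=
          mul_le_of_le_one_left (hp0 1) ((div_le_one hβ).2 hδβ)
        linarith) (fun k hk => by
        have h1 : M.devRms (k + 1) + δ / β * M.resRms (k + 1)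
            ≤ l * (M.devRms k + δ / β * M.resRms k) + 2 * (M.p.η k * (Real.sqrt n * (d * Lf))) :=
          coupled_contraction h.γ_adm hc0 hδ hδ1 hδβ (ha0 k) (hp0 k) (h.step_nonneg k)
          (h.devRms_succ_le hk) (h.resRms_succ_le hk)
        have h2 := hB k
        rw [mul_div_assoc]
        linarith) hT
    -- Rewriting β p as (β²/δ) · (δ/β) p gives the factor 1 + β⁴/δ² for passing from the contraction
    -- norm to the energy.
    have hpt : ∀ k, weight c k * (M.devRms k ^ 2 + β ^ 2 * M.resRms k ^ 2)
        ≤ (1 + β ^ 4 / δ ^ 2) * (weight c k * (M.devRms k + δ / β * M.resRms k) ^ 2) := fun k => by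
      have hwk : 0 ≤ weight c k := zero_le_one.trans (hw k)
      have hθ : 0 ≤ δ / β * M.resRms k := mul_nonneg (by positivity) (hp0 k)
      have h1 : M.devRms k ^ 2 ≤ (M.devRms k + δ / β * M.resRms k) ^ 2 :=
        pow_le_pow_left₀ (ha0 k) (by linarith) 2
      have h2 : (δ / β * M.resRms k) ^ 2 ≤ (M.devRms k + δ / β * M.resRms k) ^ 2 :=
        pow_le_pow_left₀ hθ (by linarith [ha0 k]) 2
      have h3 : β ^ 2 * M.resRms k ^ 2 = β ^ 4 / δ ^ 2 * (δ / β * M.resRms k) ^ 2 := by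
        field_simp
      have h4 := mul_le_mul_of_nonneg_left h2 (by positivity : 0 ≤ β ^ 4 / δ ^ 2)
      rw [h3]
      have := mul_le_mul_of_nonneg_left (add_le_add h1 h4) hwk
      linarith
    refine (Finset.sum_le_sum fun k _ => hpt k).trans ?_
    rw [← Finset.mul_sum, energyConst, mul_assoc]
    exact mul_le_mul_of_nonneg_left hV (by positivity)

/-! ### Optimality gap and descent in expectation -/

section Descent

variable (h : M.Valid G Lf Lm σ Rlo Rhi r ω)
include h

lemma integrable_inner_grad {k : ℕ} (hk : 1 ≤ k) (y : Vec d) (hy : y ∈ M.X) (i : Fin n) :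
    Integrable (fun s => inner ℝ (M.x k s i - y) (M.grad k s i)) M.Pr := by
  have := h.prob
  have hm : Measurable fun s => inner ℝ (M.x k s i - y) (M.grad k s i) :=
    ((h.measurable_x k i).sub measurable_const).inner (h.measurable_grad k i)
  refine Integrable.of_bound hm.aestronglyMeasurable ((Rhi + Rhi) * (d * Lf)) ?_
  filter_upwards [h.ae_norm_grad_le hk i] with s hs
  have h1 := norm_inner_le_norm (𝕜 := ℝ) (M.x k s i - y) (M.grad k s i)
  have h2 : ‖M.x k s i - y‖ ≤ Rhi + Rhi :=
    (norm_sub_le _ _).trans (add_le_add (h.norm_x_le k s i) (h.constraint.norm_le hy))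
  exact h1.trans (mul_le_mul h2 hs (norm_nonneg _) (by linarith [h.Rhi_nonneg]))

lemma integrable_gap (k : ℕ) {y : Vec d} (hy : y ∈ M.X) :
    Integrable (fun s => globalLoss M.F M.P (mean (M.x k s)) - globalLoss M.F M.P y) M.Pr := by
  have := h.prob
  have := h.probP
  have hm : Measurable fun s => globalLoss M.F M.P (mean (M.x k s)) - globalLoss M.F M.P y :=
    (h.problem.measurable_globalLoss.comp (measurable_mean (h.measurable_x k))).sub measurable_const
  refine Integrable.of_bound hm.aestronglyMeasurable (Lf * (Rhi + Rhi))
    (Filter.Eventually.of_forall fun s => ?_)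
  refine (h.problem.abs_globalLoss_sub_le h.network.ne_zero (h.mean_x_mem k s) hy).trans ?_
  refine mul_le_mul_of_nonneg_left ?_ h.Lf_pos.le
  exact (norm_sub_le _ _).trans (add_le_add (h.constraint.norm_le (h.mean_x_mem k s))
    (h.constraint.norm_le hy))

/-- The conditional mean of the estimator correlates with the optimality gap. -/
lemma gap_le_integral_inner {k : ℕ} (hk : 1 ≤ k) {y : Vec d} (hy : y ∈ M.X) :
    n * ∫ s, (globalLoss M.F M.P (mean (M.x k s)) - globalLoss M.F M.P y) ∂M.Pr
      ≤ ∑ i, ∫ s, inner ℝ (M.x k s i - y) (M.grad k s i) ∂M.Pr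
        + Lf * (Real.sqrt n * ∫ s, stackNorm (dev (M.x k s)) ∂M.Pr)
        + n * (d * Lm * M.p.μ * (2 * Rhi)) := by
  have := h.prob
  have := h.probP
  have hn : (n : ℝ) ≠ 0 := by exact_mod_cast h.network.ne_zero
  have hm : ∀ i, Measurable fun q : Vec d × (Vec d × Ξ) =>
      inner ℝ (q.1 - y) (gradEst (M.F i) M.p.μ q.1 q.2.1 q.2.2) := fun i =>
    (measurable_fst.sub measurable_const).inner (Measurable.gradEst (h.problem.measurable i) M.p.μ
      measurable_fst (measurable_fst.comp measurable_snd) (measurable_snd.comp measurable_snd))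
  -- Φ is the mean over fresh directions and samples with the current iterate frozen; by
  -- independence its expectation is that of the actual inner product.
  let Φ : Fin n → S → ℝ := fun i s => ∫ q, inner ℝ (M.x k s i - y)
    (gradEst (M.F i) M.p.μ (M.x k s i) q.1 q.2) ∂((sphereUniform d).prod (M.P i))
  have hΦ : ∀ i, Integrable (Φ i) M.Pr ∧
      ∫ s, inner ℝ (M.x k s i - y) (M.grad k s i) ∂M.Pr = ∫ s, Φ i s ∂M.Pr := fun i => by
    have hind : IndepFun (fun s => M.x k s i) (fun s => (M.u k i s, M.ξ k i s)) M.Pr :=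
      (h.indepFun_past k i).comp (φ := Prod.fst) (ψ := fun q : Vec d × Ξ × Z => (q.1, q.2.1))
        measurable_fst (by fun_prop)
    have h1 := integral_comp_of_indepFun (h.measurable_x k i)
      ((h.sampling.measurable_u k i).prodMk (h.sampling.measurable_ξ k i)) hind (hm i)
      (h.integrable_inner_grad hk y hy i)
    rw [h.map_u_ξ] at h1
    exact h1
  have hΦ' : ∀ i s, localLoss M.F M.P i (M.x k s i) - localLoss M.F M.P i y
      - d * Lm * M.p.μ * (2 * Rhi) ≤ Φ i s := fun i s => by
    refine le_trans ?_ (h.problem.inner_gradEst_ge h.constraint h.d_pos h.Lm_pos.le h.μ_pos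
      h.ε_pos h.ε_lt h.Rlo_pos h.μ_le i (h.x_mem_shrink hk s i) hy)
    have h1 : ‖M.x k s i - y‖ ≤ 2 * Rhi := by
      have := (norm_sub_le (M.x k s i) y)
      linarith [h.norm_x_le k s i, h.constraint.norm_le hy]
    have h2 : 0 ≤ d * Lm * M.p.μ := mul_nonneg (mul_nonneg (Nat.cast_nonneg _) h.Lm_pos.le)
      h.μ_pos.le
    have := mul_le_mul_of_nonneg_left h1 h2
    linarith
  have hsum : ∀ s, n * (globalLoss M.F M.P (mean (M.x k s)) - globalLoss M.F M.P y)
      ≤ (∑ i, Φ i s + (Lf * Real.sqrt n) * stackNorm (dev (M.x k s)))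
        + n * (d * Lm * M.p.μ * (2 * Rhi)) := fun s => by
    have h1 : n * (globalLoss M.F M.P (mean (M.x k s)) - globalLoss M.F M.P y)
        = ∑ i, (localLoss M.F M.P i (mean (M.x k s)) - localLoss M.F M.P i y) := by
      rw [globalLoss, globalLoss, ← mul_sub, ← mul_assoc, mul_one_div_cancel hn, one_mul,
        Finset.sum_sub_distrib]
    -- Moving the evaluation point from the average to the agent's own iterate costs Lf times its
    -- deviation.
    have h2 : ∀ i, localLoss M.F M.P i (mean (M.x k s)) - localLoss M.F M.P i y
        ≤ Φ i s + Lf * ‖dev (M.x k s) i‖ + d * Lm * M.p.μ * (2 * Rhi) := fun i => by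
      have h3 := (abs_le.1 (h.problem.abs_localLoss_sub_le i (h.x_mem k s i)
        (h.mean_x_mem k s))).1
      have h4 := hΦ' i s
      have h5 : M.x k s i - mean (M.x k s) = dev (M.x k s) i := rfl
      rw [h5] at h3
      linarith
    rw [h1]
    refine (Finset.sum_le_sum fun i _ => h2 i).trans ?_
    rw [Finset.sum_add_distrib, Finset.sum_add_distrib, ← Finset.mul_sum]
    have h6 := mul_le_mul_of_nonneg_left (sum_norm_le_stackNorm (dev (M.x k s))) h.Lf_pos.le
    simp only [Finset.sum_const, Finset.card_univ, Fintype.card_fin, nsmul_eq_mul]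
    linarith
  have hi1 : Integrable (fun s => ∑ i, Φ i s) M.Pr := integrable_finsetSum _ fun i _ => (hΦ i).1
  have hi2 : Integrable (fun s => (Lf * Real.sqrt n) * stackNorm (dev (M.x k s))) M.Pr :=
    ((h.memLp_stackNorm_dev k).integrable one_le_two).const_mul _
  have hmono := integral_mono ((h.integrable_gap k hy).const_mul (n : ℝ))
    ((hi1.add hi2).add (integrable_const _)) hsum
  rw [integral_const_mul] at hmono
  refine hmono.trans_eq ?_
  rw [integral_add' (hi1.add hi2) (integrable_const _), integral_add' hi1 hi2, integral_const_mul,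
    integral_finsetSum _ fun i _ => (hΦ i).1, integral_const, probReal_univ, one_smul,
    ← mul_assoc Lf]
  simp_rw [fun i => (hΦ i).2]

/-- The descent inequality in expectation. -/
lemma sqDist_succ_le {k : ℕ} (hk : 1 ≤ k) {y : Vec d} (hy : y ∈ shrink M.X M.p.ε) :
    M.sqDist y (k + 1) ≤ M.sqDist y k
      - 2 * M.p.η k * ∑ i, ∫ s, inner ℝ (M.x k s i - y) (M.grad k s i) ∂M.Pr
      + (5 + 2 * laplacianNorm M.W + 4 * laplacianNorm M.W ^ 2)
        * (M.devRms k ^ 2 + laplacianNorm M.W ^ 2 * M.resRms k ^ 2)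
      + 2 * (M.p.η k * (Real.sqrt n * (d * Lf))) ^ 2 := by
  have := h.prob
  have hγ := h.γ_adm.1
  have hγ1 := h.γ_adm.2.1
  have hyX := h.shrink_subset hy
  set β := laplacianNorm M.W
  set Q := 5 + 2 * β + 4 * β ^ 2
  have hpt : ∀ᵐ s ∂M.Pr, stackNorm (fun i => M.x (k + 1) s i - y) ^ 2
      ≤ stackNorm (fun i => M.x k s i - y) ^ 2
        - 2 * M.p.η k * ∑ i, inner ℝ (M.x k s i - y) (M.grad k s i)
        + Q * (stackNorm (dev (M.x k s)) ^ 2 + β ^ 2 * stackNorm (M.res k s) ^ 2)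
        + 2 * (M.p.η k * (Real.sqrt n * (d * Lf))) ^ 2 := by
    filter_upwards [h.ae_stackNorm_grad_le hk] with s hs
    have h1 := h.network.stackNorm_step_sub_const_sq_le h.isClosed_shrink h.convex_shrink hγ.le
      hγ1.le hy (M.x_succ k s)
    have h2 : (M.p.η k * stackNorm (M.grad k s)) ^ 2
        ≤ (M.p.η k * (Real.sqrt n * (d * Lf))) ^ 2 :=
      pow_le_pow_left₀ (mul_nonneg (h.η_nonneg k) (stackNorm_nonneg _))
        (mul_le_mul_of_nonneg_left hs (h.η_nonneg k)) 2
    linarith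
  have hsub : ∀ k, MemLp (fun s => stackNorm (fun i => M.x k s i - y)) 2 M.Pr := fun k =>
    memLp_stackNorm (fun i => (h.measurable_x k i).sub measurable_const)
      fun i => (h.memLp_x k i).sub (memLp_const y)
  have i1 := (hsub k).integrable_sq
  have i2 : Integrable (fun s => 2 * M.p.η k * ∑ i, inner ℝ (M.x k s i - y) (M.grad k s i)) M.Pr :=
    (integrable_finsetSum _ fun i _ => h.integrable_inner_grad hk y hyX i).const_mul _
  have i3 := (h.memLp_stackNorm_dev k).integrable_sq
  have i4 := (h.memLp_stackNorm_res k).integrable_sq.const_mul (β ^ 2)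
  have i5 := (i3.add i4).const_mul Q
  have hmono := integral_mono_ae (hsub (k + 1)).integrable_sq
    (((i1.sub i2).add i5).add (integrable_const (2 * (M.p.η k * (Real.sqrt n * (d * Lf))) ^ 2))) hpt
  refine hmono.trans_eq ?_
  rw [integral_add' ((i1.sub i2).add i5) (integrable_const _), integral_add' (i1.sub i2) i5,
    integral_sub' i1 i2, integral_const_mul, integral_const_mul, integral_add' i3 i4,
    integral_const_mul, integral_const, probReal_univ, one_smul,
    integral_finsetSum _ fun i _ => h.integrable_inner_grad hk y hyX i, devRms, resRms, rms_sq,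
    rms_sq, sqDist]

omit h in
lemma sqDist_nonneg (y : Vec d) (k : ℕ) : 0 ≤ M.sqDist y k :=
  integral_nonneg fun _ => sq_nonneg _

lemma sqDist_le {y : Vec d} (hy : y ∈ M.X) (k : ℕ) : M.sqDist y k ≤ n * (2 * Rhi) ^ 2 := by
  have := h.prob
  have hpt : ∀ s, stackNorm (fun i => M.x k s i - y) ^ 2 ≤ n * (2 * Rhi) ^ 2 := fun s => by
    have h1 : stackNorm (fun i => M.x k s i - y) ≤ Real.sqrt n * (2 * Rhi) :=
      stackNorm_le_of_forall (by linarith [h.Rhi_nonneg]) fun i => by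
        have := norm_sub_le (M.x k s i) y
        linarith [h.norm_x_le k s i, h.constraint.norm_le hy]
    refine (pow_le_pow_left₀ (stackNorm_nonneg _) h1 2).trans_eq ?_
    rw [mul_pow, Real.sq_sqrt (Nat.cast_nonneg _)]
  have h2 := integral_mono_of_nonneg (μ := M.Pr) (Filter.Eventually.of_forall fun s => sq_nonneg
    (stackNorm (fun i => M.x k s i - y))) (integrable_const _) (Filter.Eventually.of_forall hpt)
  simpa [sqDist] using h2

/-- Young's inequality turns the first-order disagreement into the weighted energy plus 1/w; with w
= √(k+c) both sum to O(√(T+c)). -/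
lemma integral_stackNorm_dev_le (k : ℕ) {w : ℝ} (hw : 0 < w) :
    ∫ s, stackNorm (dev (M.x k s)) ∂M.Pr ≤ (w * M.devRms k ^ 2 + 1 / w) / 2 := by
  have := h.prob
  have hpt : ∀ s, stackNorm (dev (M.x k s))
      ≤ w / 2 * stackNorm (dev (M.x k s)) ^ 2 + 1 / w / 2 := fun s => by
    set t := stackNorm (dev (M.x k s))
    have : 0 ≤ w * (t - 1 / w) ^ 2 := by positivity
    have e : w * (t - 1 / w) ^ 2 = w * t ^ 2 - 2 * t + 1 / w := by field_simp; ring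
    linarith
  have i1 := (h.memLp_stackNorm_dev k).integrable_sq.const_mul (w / 2)
  have hmono := integral_mono ((h.memLp_stackNorm_dev k).integrable one_le_two)
    (i1.add (integrable_const (1 / w / 2))) hpt
  refine hmono.trans_eq ?_
  rw [integral_add' i1 (integrable_const _), integral_const_mul, integral_const, probReal_univ,
    one_smul, devRms, rms_sq]
  ring

end Descent

end Valid

end System

/-! ### Regret bounds -/

namespace System.Valid

variable {n d : ℕ} {Ξ Z S : Type*} [MeasurableSpace Ξ] [MeasurableSpace Z] [MeasurableSpace S]
  {M : System n d Ξ Z S} {G : SimpleGraph (Fin n)} {Lf Lm σ Rlo Rhi r ω : ℝ}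

/-- The regret against a point of the shrunk set, for step sizes `1 / (m √(k + c))`. -/
lemma sum_gap_le (h : M.Valid G Lf Lm σ Rlo Rhi r ω) {c m B : ℝ} (hc : 4 < c) (hm : 0 < m)
    (hη : ∀ k, M.p.η k = 1 / (m * weight c k)) (hB : Real.sqrt n * (d * Lf) = m * B) {T : ℕ}
    (hT : 1 ≤ T) {y : Vec d} (hy : y ∈ shrink M.X M.p.ε) :
    n * ∑ k ∈ Finset.Icc 1 T,
        ∫ s, (globalLoss M.F M.P (mean (M.x k s)) - globalLoss M.F M.P y) ∂M.Pr
      ≤ (m / 2 * (n * (2 * Rhi) ^ 2 + (5 + 2 * laplacianNorm M.W + 4 * laplacianNorm M.W ^ 2)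
            * energyConst n (spectralGap M.W) (laplacianNorm M.W) M.p.γ B Rhi) + 2 * m * B ^ 2
          + Lf * Real.sqrt n / 2
            * (energyConst n (spectralGap M.W) (laplacianNorm M.W) M.p.γ B Rhi + 2)) * weight c T
        + T * (n * (d * Lm * M.p.μ * (2 * Rhi))) := by
  have hyX := h.shrink_subset hy
  have hw : ∀ k, 0 < weight c k := fun k => zero_lt_one.trans_le (one_le_weight hc k)
  have hstep : ∀ k, M.p.η k * (Real.sqrt n * (d * Lf)) = B / weight c k := fun k => by
    have := (hw k).ne'
    rw [hη, hB]; field_simp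
  have hE := h.sum_energy_le hc (fun k => (hstep k).le) hT
  set β := laplacianNorm M.W
  set E := energyConst n (spectralGap M.W) β M.p.γ B Rhi
  set Q := 5 + 2 * β + 4 * β ^ 2 with hQ
  have hβ : 0 ≤ β := specNorm_nonneg _
  have hQ0 : 0 ≤ Q := by positivity
  have hpt : ∀ k ∈ Finset.Icc 1 T,
      n * ∫ s, (globalLoss M.F M.P (mean (M.x k s)) - globalLoss M.F M.P y) ∂M.Pr
        ≤ m / 2 * (weight c k * (M.sqDist y k - M.sqDist y (k + 1)))
          + (m / 2 * Q + Lf * Real.sqrt n / 2)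
            * (weight c k * (M.devRms k ^ 2 + β ^ 2 * M.resRms k ^ 2))
          + (m * B ^ 2 + Lf * Real.sqrt n / 2) * (1 / weight c k)
          + n * (d * Lm * M.p.μ * (2 * Rhi)) := fun k hk => by
    have hk1 := (Finset.mem_Icc.1 hk).1
    have h1 := h.gap_le_integral_inner hk1 hyX
    have h2 := h.sqDist_succ_le hk1 hy
    rw [hstep] at h2
    have h3 := h.integral_stackNorm_dev_le k (hw k)
    -- The multiplier m w_k / 2 equals 1/(2 η_k), which normalises the inner product term.
    have h4 : m * weight c k / 2
        * (2 * M.p.η k * ∑ i, ∫ s, inner ℝ (M.x k s i - y) (M.grad k s i) ∂M.Pr)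
        = ∑ i, ∫ s, inner ℝ (M.x k s i - y) (M.grad k s i) ∂M.Pr := by
      have := (hw k).ne'
      rw [hη]; field_simp
    have hmw : 0 ≤ m * weight c k / 2 := by have := hw k; positivity
    have h5 := mul_le_mul_of_nonneg_left h2 hmw
    have h6 : m * weight c k / 2 * (2 * (B / weight c k) ^ 2) = m * B ^ 2 * (1 / weight c k) := by
      have := (hw k).ne'
      field_simp
    have h7 := mul_le_mul_of_nonneg_left h3
      (mul_nonneg h.Lf_pos.le (Real.sqrt_nonneg (n : ℝ)))
    have h8 : 0 ≤ Lf * Real.sqrt n / 2 * (weight c k * (β ^ 2 * M.resRms k ^ 2)) := by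
      have := hw k
      have := h.Lf_pos
      positivity
    linarith
  rw [Finset.mul_sum]
  refine (Finset.sum_le_sum hpt).trans ?_
  rw [Finset.sum_add_distrib, Finset.sum_add_distrib, Finset.sum_add_distrib, ← Finset.mul_sum,
    ← Finset.mul_sum, ← Finset.mul_sum, Finset.sum_const, Nat.card_Icc, nsmul_eq_mul,
    Nat.add_sub_cancel]
  have hD := sum_weight_mul_sub_le hc (fun k _ => sqDist_nonneg y k)
    (fun k _ => h.sqDist_le hyX k) T
  have hI := sum_inv_weight_le hc T
  have hLf : 0 ≤ Lf * Real.sqrt n / 2 := by have := h.Lf_pos; positivity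
  have g1 := mul_le_mul_of_nonneg_left hD (by positivity : 0 ≤ m / 2)
  have g2 := mul_le_mul_of_nonneg_left hE (by positivity : 0 ≤ m / 2 * Q + Lf * Real.sqrt n / 2)
  have g3 := mul_le_mul_of_nonneg_left hI (by positivity : 0 ≤ m * B ^ 2 + Lf * Real.sqrt n / 2)
  linarith

end System.Valid

/-- The constant in the final bound. -/
noncomputable def regretConst (n : ℕ) (δ β Lf Lm Rlo Rhi γ : ℝ) : ℝ :=
  let m := (5 + 10 / (n : ℝ)) * 4 * Lm
  let B := Real.sqrt n * Lf / m
  let E := energyConst n δ β γ B Rhi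
  -- The absolute value gives nonnegativity without any condition on the parameters.
  |(m / 2 * (n * (2 * Rhi) ^ 2 + (5 + 2 * β + 4 * β ^ 2) * E) + 2 * m * B ^ 2
    + Lf * Real.sqrt n / 2 * (E + 2) + n * (2 * Lm * Rhi + 2 * Lf * Rlo * Rhi)) / n|

lemma regretConst_nonneg (n : ℕ) (δ β Lf Lm Rlo Rhi γ : ℝ) :
    0 ≤ regretConst n δ β Lf Lm Rlo Rhi γ := abs_nonneg _

namespace System.Valid

variable {n d : ℕ} {Ξ Z S : Type*} [MeasurableSpace Ξ] [MeasurableSpace Z] [MeasurableSpace S]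
  {M : System n d Ξ Z S} {G : SimpleGraph (Fin n)} {Lf Lm σ Rlo Rhi r ω : ℝ}

/-- The regret against a minimizer, for the prescribed parameters. -/
lemma sum_gap_smoothParams_le (h : M.Valid G Lf Lm σ Rlo Rhi r ω) {c ψ γ : ℝ} (hc : 4 < c) {T : ℕ}
    (hT : 1 ≤ T) (hp : M.p = smoothParams n d T Lm Rlo c ψ γ) {y : Vec d} (hy : y ∈ M.X) :
    ∑ k ∈ Finset.Icc 1 T,
        ∫ s, (globalLoss M.F M.P (mean (M.x k s)) - globalLoss M.F M.P y) ∂M.Pr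
      ≤ regretConst n (spectralGap M.W) (laplacianNorm M.W) Lf Lm Rlo Rhi γ
        * (d * Real.sqrt (T + c)) := by
  have := h.prob
  have := h.probP
  have hn : (0 : ℝ) < n := by exact_mod_cast Nat.pos_of_ne_zero h.network.ne_zero
  have hd : (1 : ℝ) ≤ d := by exact_mod_cast h.d_pos
  have hLf := h.Lf_pos
  have hLm := h.Lm_pos
  have hRlo := h.Rlo_pos
  have hRhi := h.Rhi_nonneg
  have hT0 : (0 : ℝ) < T := by exact_mod_cast hT
  have hsT : 0 < Real.sqrt T := Real.sqrt_pos.2 hT0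
  have hμ : M.p.μ = 1 / Real.sqrt T := by rw [hp]; rfl
  have hε : M.p.ε = 2 * Rlo / Real.sqrt T := by rw [hp]; rfl
  have hγ : M.p.γ = γ := by rw [hp]; rfl
  set m := (5 + 10 / (n : ℝ)) * 4 * Lm with hm
  have hm0 : 0 < m := by positivity
  set B := Real.sqrt n * Lf / m with hB
  have hη : ∀ k, M.p.η k = 1 / (d * m * weight c k) := fun k => by
    rw [hp, hm]
    simp only [smoothParams, weight]
    ring_nf
  -- The descent inequality needs a comparator in Ω_ε, so y is scaled by 1 - ε at a cost of Lf ε Rhi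
  -- per step.
  have hy' : (1 - M.p.ε) • y ∈ shrink M.X M.p.ε := ⟨y, hy, rfl⟩
  -- Taking d out of the step-size constant leaves B, and hence the energy constant, independent of
  -- the dimension.
  have h1 := h.sum_gap_le (m := d * m) (B := B) hc (by positivity) hη
    (by rw [hB]; field_simp) hT hy'
  have h2 : globalLoss M.F M.P ((1 - M.p.ε) • y) - globalLoss M.F M.P y ≤ Lf * (M.p.ε * Rhi) := by
    refine (le_abs_self _).trans ((h.problem.abs_globalLoss_sub_le h.network.ne_zero
      (h.shrink_subset hy') hy).trans ?_)
    have e : (1 - M.p.ε) • y - y = -(M.p.ε • y) := by rw [sub_smul, one_smul]; abel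
    rw [e, norm_neg, norm_smul, Real.norm_eq_abs, abs_of_pos h.ε_pos]
    have := h.ε_pos
    gcongr
    exact h.constraint.norm_le hy
  have h3 : ∀ k, ∫ s, (globalLoss M.F M.P (mean (M.x k s)) - globalLoss M.F M.P y) ∂M.Pr
      ≤ ∫ s, (globalLoss M.F M.P (mean (M.x k s))
          - globalLoss M.F M.P ((1 - M.p.ε) • y)) ∂M.Pr + Lf * (M.p.ε * Rhi) := fun k => by
    have i1 := h.integrable_gap k (h.shrink_subset hy')
    have h4 := integral_mono (h.integrable_gap k hy)
      (i1.add (integrable_const (Lf * (M.p.ε * Rhi)))) (fun s => by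
        simp only [Pi.add_apply]
        linarith)
    refine h4.trans_eq ?_
    rw [integral_add' i1 (integrable_const _), integral_const, probReal_univ, one_smul]
  have h5 := Finset.sum_le_sum fun k (_ : k ∈ Finset.Icc 1 T) => h3 k
  rw [Finset.sum_add_distrib, Finset.sum_const, Nat.card_Icc, nsmul_eq_mul,
    Nat.add_sub_cancel] at h5
  have hTs : (T : ℝ) / Real.sqrt T = Real.sqrt T := Real.div_sqrt
  have h6 : (T : ℝ) * (Lf * (M.p.ε * Rhi)) = 2 * Lf * Rlo * Rhi * Real.sqrt T := by
    rw [hε]; linear_combination (2 * Lf * Rlo * Rhi) * hTs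
  have h7 : (T : ℝ) * (n * (d * Lm * M.p.μ * (2 * Rhi)))
      = n * (2 * d * Lm * Rhi) * Real.sqrt T := by
    rw [hμ]; linear_combination (n * (2 * d * Lm * Rhi)) * hTs
  have h8 : Real.sqrt T ≤ weight c T := by
    unfold weight; gcongr; linarith
  have hw : 0 < weight c T := hsT.trans_le h8
  rw [h6] at h5
  rw [h7, hγ] at h1
  set β := laplacianNorm M.W
  have hβ : 0 ≤ β := specNorm_nonneg _
  set E := energyConst n (spectralGap M.W) β γ B Rhi with hE
  have hE0 : 0 ≤ E := energyConst_nonneg (hγ ▸ h.γ_adm.1.le) h.γ_adm.delta_pos.le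
  have h9 := mul_le_mul_of_nonneg_left h5 hn.le
  set K := (m / 2 * (n * (2 * Rhi) ^ 2 + (5 + 2 * β + 4 * β ^ 2) * E) + 2 * m * B ^ 2
    + Lf * Real.sqrt n / 2 * (E + 2) + n * (2 * Lm * Rhi + 2 * Lf * Rlo * Rhi)) with hK
  have hreg : K / n ≤ regretConst n (spectralGap M.W) β Lf Lm Rlo Rhi γ := le_abs_self _
  have h10 : n * ∑ k ∈ Finset.Icc 1 T,
      ∫ s, (globalLoss M.F M.P (mean (M.x k s)) - globalLoss M.F M.P y) ∂M.Pr
      ≤ K * (d * weight c T) := by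
    have a1 : n * (2 * d * Lm * Rhi) * Real.sqrt T ≤ n * (2 * d * Lm * Rhi) * weight c T := by
      gcongr
    have a2 : n * (2 * Lf * Rlo * Rhi * Real.sqrt T)
        ≤ n * (2 * Lf * Rlo * Rhi * (d * weight c T)) := by
      have : Real.sqrt T ≤ d * weight c T := h8.trans (le_mul_of_one_le_left hw.le hd)
      gcongr
    have a3 : Lf * Real.sqrt n / 2 * (E + 2) * weight c T
        ≤ Lf * Real.sqrt n / 2 * (E + 2) * (d * weight c T) := by
      have : weight c T ≤ d * weight c T := le_mul_of_one_le_left hw.le hd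
      gcongr
    rw [hK]
    linarith
  have h11 : ∑ k ∈ Finset.Icc 1 T,
      ∫ s, (globalLoss M.F M.P (mean (M.x k s)) - globalLoss M.F M.P y) ∂M.Pr
      ≤ K / n * (d * weight c T) := by
    rw [div_mul_eq_mul_div, le_div_iff₀ hn]
    linarith
  exact h11.trans (mul_le_mul_of_nonneg_right hreg (by positivity))

end System.Valid

end ComDSZO

theorem corollary1 (n : ℕ) (δ β Lf Lm σ Rlo Rhi γ : ℝ) (hLf : 0 < Lf) (hLm : 0 < Lm)
    (hσ : 0 < σ) (hRlo : 0 < Rlo) (hquery : 1 ≤ 2 * Rlo ^ 2) :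
    ∃ K : ℝ, ∀ (d T : ℕ) (r ω ψ c : ℝ), 0 < d → 1 ≤ r → 0 < ω → ω ≤ 1 → 0 < ψ → ψ ≤ r⁻¹ → 4 < c →
      ComDSZO.GammaAdmissible δ β γ (ψ * r * ω / 2) →
      0 < T → 2 * Rlo / Real.sqrt T < 1 →
      ∀ (G : SimpleGraph (Fin n)) (W : Matrix (Fin n) (Fin n) ℝ),
      ComDSZO.IsNetwork G W → ComDSZO.spectralGap W = δ → ComDSZO.laplacianNorm W = β →
      ∀ (Ξ : Type*) [MeasurableSpace Ξ] (P : Fin n → Measure Ξ) [∀ i, IsProbabilityMeasure (P i)]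
        (X : Set (ComDSZO.Vec d)) (F : Fin n → ComDSZO.Vec d → Ξ → ℝ),
      ComDSZO.IsConstraintSet X Rlo Rhi → ComDSZO.IsSmoothProblem X F P Lf Lm σ →
      ∀ (Z : Type*) [MeasurableSpace Z] (ν : Measure Z) [IsProbabilityMeasure ν]
        (C : ComDSZO.Vec d → Z → ComDSZO.Vec d),
      ComDSZO.IsCompressor C ν r ω →
      ∀ (S : Type*) [MeasurableSpace S] (Pr : Measure S) [IsProbabilityMeasure Pr]
        (u : ℕ → Fin n → S → ComDSZO.Vec d) (ξ : ℕ → Fin n → S → Ξ) (ζ : ℕ → Fin n → S → Z),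
      ComDSZO.IsSampling Pr P ν u ξ ζ →
      ∀ (x₀ : Fin n → ComDSZO.Vec d), (∀ i, x₀ i ∈ X) →
      ∀ xstar ∈ X, (∀ x ∈ X, ComDSZO.globalLoss F P xstar ≤ ComDSZO.globalLoss F P x) →
      let xbar : ℕ → S → ComDSZO.Vec d := fun k s =>
        (ComDSZO.run (ComDSZO.smoothParams n d T Lm Rlo c ψ γ) W X F C x₀
          (fun k i => u k i s) (fun k i => ξ k i s) (fun k i => ζ k i s) k).avg
      let gap : ℕ → S → ℝ := fun k s =>
        ComDSZO.globalLoss F P (xbar k s) - ComDSZO.globalLoss F P xstar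
      (∀ k ∈ Finset.Icc 1 T, Integrable (gap k) Pr) ∧
      (∑ k ∈ Finset.Icc 1 T, ∫ s, gap k s ∂Pr
        ≤ K * ((d : ℝ) ^ 2 * Real.sqrt (T + c) / (ψ * r * ω) ^ 2)) ∧
      (∀ ρ : ℝ, 0 < ρ → ρ ≤ ψ * r * ω →
        ∑ k ∈ Finset.Icc 1 T, ∫ s, gap k s ∂Pr ≤ K / ρ ^ 2 * ((d : ℝ) ^ 2 * Real.sqrt (T + c))) := by
  refine ⟨ComDSZO.regretConst n δ β Lf Lm Rlo Rhi γ, ?_⟩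
  intro d T r ω ψ c hd hr hω hω1 hψ hψr hc hγ hT hε G W hW hδ hβ Ξ _ P _ X F hX hF Z _ ν _ C hC S _
    Pr _ u ξ ζ hs x₀ hx₀ y hy _ xbar gap
  subst hδ hβ
  have hn : (0 : ℝ) < n := by exact_mod_cast Nat.pos_of_ne_zero hW.ne_zero
  have hd0 : (1 : ℝ) ≤ d := by exact_mod_cast hd
  have hsT : 0 < Real.sqrt T := Real.sqrt_pos.2 (by exact_mod_cast hT)
  let M : ComDSZO.System n d Ξ Z S :=
    { p := ComDSZO.smoothParams n d T Lm Rlo c ψ γ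
      W := W, X := X, F := F, C := C, x₀ := x₀, u := u, ξ := ξ, ζ := ζ, P := P, ν := ν, Pr := Pr }
  have hM : M.Valid G Lf Lm σ Rlo Rhi r ω :=
    { network := hW
      constraint := hX
      problem := hF
      compressor := hC
      sampling := hs
      prob := inferInstance
      probP := inferInstance
      probν := inferInstance
      start := hx₀
      d_pos := hd
      Lf_pos := hLf
      Lm_pos := hLm
      Rlo_pos := hRlo
      one_le_r := hr
      ω_pos := hω
      ω_le := hω1
      ψ_pos := hψ
      ψ_le := hψr
      γ_adm := hγ
      μ_pos := one_div_pos.2 hsT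
      ε_pos := div_pos (by linarith) hsT
      ε_lt := hε
      -- This is the condition 2 Rlo² ≥ 1 multiplied by 1/√T.
      μ_le := by
        change 1 / Real.sqrt T ≤ 2 * Rlo / Real.sqrt T * Rlo
        rw [div_mul_eq_mul_div]
        gcongr
        linarith
      η_nonneg := fun k => by
        change 0 ≤ 1 / ((5 + 10 / (n : ℝ)) * 4 * d * Lm * Real.sqrt (k + c))
        positivity }
  have hgap : ∀ k s, gap k s = ComDSZO.globalLoss F P (ComDSZO.mean (M.x k s))
      - ComDSZO.globalLoss F P y := fun _ _ => rfl
  have hsum : ∑ k ∈ Finset.Icc 1 T, ∫ s, gap k s ∂Pr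
      ≤ ComDSZO.regretConst n (ComDSZO.spectralGap W) (ComDSZO.laplacianNorm W) Lf Lm Rlo Rhi γ
        * (d * Real.sqrt (T + c)) := hM.sum_gap_smoothParams_le hc hT rfl hy
  have hK := ComDSZO.regretConst_nonneg n (ComDSZO.spectralGap W) (ComDSZO.laplacianNorm W) Lf Lm
    Rlo Rhi γ
  set K := ComDSZO.regretConst n (ComDSZO.spectralGap W) (ComDSZO.laplacianNorm W) Lf Lm Rlo Rhi γ
  have h0 : 0 < ψ * r * ω := hM.ψrω_pos
  have h1 : ψ * r * ω ≤ 1 := hM.ψrω_le_one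
  -- The bound K d √(T+c) is stronger than both claims, since ρ² ≤ 1 ≤ d; the case ρ = ψrω gives the
  -- first.
  have hρ : ∀ ρ : ℝ, 0 < ρ → ρ ≤ ψ * r * ω → ∑ k ∈ Finset.Icc 1 T, ∫ s, gap k s ∂Pr
      ≤ K * ((d : ℝ) ^ 2 * Real.sqrt (T + c) / ρ ^ 2) := fun ρ hρ0 hρ1 => by
    refine hsum.trans (mul_le_mul_of_nonneg_left ?_ hK)
    rw [le_div_iff₀ (by positivity)]
    have h2 : ρ ^ 2 ≤ 1 := pow_le_one₀ hρ0.le (hρ1.trans h1)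
    calc (d : ℝ) * Real.sqrt (T + c) * ρ ^ 2 ≤ d * Real.sqrt (T + c) * d := by
          gcongr
          exact h2.trans hd0
      _ = (d : ℝ) ^ 2 * Real.sqrt (T + c) := by ring
  refine ⟨fun k _ => hM.integrable_gap k hy, hρ _ h0 le_rfl, fun ρ hρ0 hρ1 => ?_⟩
  refine (hρ ρ hρ0 hρ1).trans_eq ?_
  ring
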